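/- Let $\mathfrak g=\mathfrak g_{\bar 0}\oplus\mathfrak g_{\bar 1}$ be a finite-dimensional Lie superalgebra over $\mathbb C$ with $\mathfrak g_{\bar 0}$ reductive, with a commutative subalgebra $\mathfrak h\subset\mathfrak g_{\bar 0}$ giving a root space decomposition $\mathfrak g=\mathfrak h\oplus\bigoplus_{\alpha\in\Delta}\mathfrak g_\alpha$, $\Delta\subset\mathfrak h^*\setminus\{0\}$, and with a nondegenerate even supersymmetric invariant bilinear form; $(\cdot,\cdot)$ also denotes the induced form on $\mathfrak h^*$. (Examples: $\mathfrak{gl}(m|n)$ and all finite-dimensional contragredient Lie superalgebras with indecomposable Cartan matrix, that is $\mathfrak{sl}(m|n)$ with $m\neq n$, $\mathfrak{gl}(n|n)$, $\mathfrak{osp}(m|2n)$, $D(2,1,\alpha)$, $F(4)$, $G(3)$.) For a finite-dimensional $\mathfrak g$-module $M$ with (generalised) weight spaces $M^\mu=M^\mu_{\bar 0}\oplus M^\mu_{\bar 1}$, let $\operatorname{sch}M=\sum_\mu(\dim M^\mu_{\bar 0}-\dim M^\mu_{\bar 1})e^\mu\in\mathbb Z[\mathfrak h^*]$, and let $\mathcal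 J_{\mathfrak g}\subset\mathbb Z[\mathfrak h^*]$ be the additive span of all $\operatorname{sch}M$ (the supercharacter ring). For $y\in\mathfrak g_{\bar 1}$ with $[y,y]=0$ put $\mathfrak g^y=\{a\in\mathfrak g:[y,a]=0\}$, $\mathfrak g_y=\mathfrak g^y/[y,\mathfrak g]$, let $\mathfrak h_y$ be the image of $\mathfrak h\cap\mathfrak g^y$ in $\mathfrak g_y$, and for a $\mathfrak g$-module $M$ let $M_y=\operatorname{Ker}_M y/yM$, a $\mathfrak g_y$-module. The map $ds_y:\mathcal J_{\mathfrak g}\to\mathcal J_{\mathfrak g_y}$, where $\mathcal J_{\mathfrak g_y}\subset\mathbb Z[\mathfrak h_y^*]$, is the well-defined additive map with $ds_y(\operatorname{sch}M)=\operatorname{sch}M_y$. Let $\beta_1,\dots,\beta_k\in\Delta$ be linearly independent, mutually orthogonal, isotropic odd roots, let $x_{\beta_i}\in(\mathfrak g_{\beta_i})_{\bar 1}$, and let $x=x_{\beta_1}+\cdots+x_{\beta_k}$. Then: * $[x_{\beta_i},x_{\beta_j}]=0$ for all $i,j$. Hence $[x,x]=0$, and the algebra $\mathfrak g'=(\cdots((\mathfrak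 g_{x_{\beta_k}})_{x_{\beta_{k-1}}})\cdots)_{x_{\beta_1}}$ is defined; at each step $x_{\beta_i}$ stands for its class. * There is an isomorphism of Lie superalgebras $\Phi:\mathfrak g_x\to\mathfrak g'$ that maps $\mathfrak h_x$ onto the corresponding subspace $\mathfrak h'$ of $\mathfrak g'$ and sends the class of every homogeneous $a\in\bigcap_i\mathfrak g^{x_{\beta_i}}$ in $\mathfrak g_x$ to its class in $\mathfrak g'$. * Under the identification $\mathbb Z[\mathfrak h_x^*]\cong\mathbb Z[\mathfrak h'^*]$ induced by $\Phi$, for all $f\in\mathcal J_{\mathfrak g}$ $$ds_x(f)=ds_{x_{\beta_1}}\circ\cdots\circ ds_{x_{\beta_k}}(f).$$ -/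

import Mathlib

universe u

noncomputable section

namespace DufloSerganova

section Weights

variable {t t' V W Q : Type*} [AddCommGroup t] [Module ℂ t] [AddCommGroup t'] [Module ℂ t']
  [AddCommGroup V] [Module ℂ V] [AddCommGroup W] [Module ℂ W] [AddCommGroup Q] [Module ℂ Q]

/-- The weight space `V^μ` of a space with commuting operators `T a`, as a joint generalised
eigenspace. It is the ordinary weight space whenever the operators are diagonalisable. -/
def weightSpace (T : t →ₗ[ℂ] Module.End ℂ V) (μ : Module.Dual ℂ t) : Submodule ℂ V :=
  ⨅ a : t, (T a).maxGenEigenspace (μ a)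

theorem mem_weightSpace (T : t →ₗ[ℂ] Module.End ℂ V) (μ : Module.Dual ℂ t) (v : V) :
    v ∈ weightSpace T μ ↔ ∀ a, ∃ k : ℕ, ((T a - μ a • (1 : Module.End ℂ V)) ^ k) v = 0 := by
  simp [weightSpace]

theorem weightSpace_indep (T : t →ₗ[ℂ] Module.End ℂ V) (hT : ∀ a b, Commute (T a) (T b)) :
    iSupIndep (weightSpace T) := by
  have h := Module.End.independent_iInf_maxGenEigenspace_of_forall_mapsTo (fun a => T a)
    (fun i j φ => Module.End.mapsTo_maxGenEigenspace_of_comm (hT j i) φ)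
  exact h.comp (f := fun μ : Module.Dual ℂ t => (μ : t → ℂ)) DFunLike.coe_injective

theorem scalar_eq_zero {c : ℂ} {S : Module.End ℂ V} (hS : ∀ v, S v = c • v)
    {v : V} (hv : v ≠ 0) {k : ℕ} (h : (S ^ k) v = 0) : c = 0 := by
  have : ∀ k : ℕ, (S ^ k) v = c ^ k • v := by
    intro k
    induction k with
    | zero => simp
    | succ k ih => rw [pow_succ', Module.End.mul_apply, ih, hS, smul_smul, pow_succ']
  rw [this] at h
  rcases smul_eq_zero.mp h with h | h
  · exact by_contra fun hc => pow_ne_zero k hc h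
  · exact absurd h hv

theorem exists_pow_add {A B : Module.End ℂ V} (h : Commute A B) {v : V} {k l : ℕ}
    (hA : (A ^ k) v = 0) (hB : (B ^ l) v = 0) : ((A + B) ^ (k + l)) v = 0 := by
  rw [h.add_pow']
  rw [LinearMap.sum_apply]
  refine Finset.sum_eq_zero fun ⟨i, j⟩ hij => ?_
  replace hij : i + j = k + l := Finset.HasAntidiagonal.mem_antidiagonal.mp hij
  rw [LinearMap.smul_apply]
  dsimp only
  rcases le_or_gt k i with hi | hi
  · obtain ⟨d, rfl⟩ := Nat.exists_eq_add_of_le hi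
    rw [(h.pow_pow _ _).eq, pow_add, (Commute.pow_pow_self A k d).eq]
    simp [Module.End.mul_apply, hA]
  · have : l ≤ j := by omega
    obtain ⟨d, rfl⟩ := Nat.exists_eq_add_of_le this
    rw [pow_add, (Commute.pow_pow_self B l d).eq]
    simp [Module.End.mul_apply, hB]

theorem weight_linear (T : t →ₗ[ℂ] Module.End ℂ V) (hT : ∀ a b, Commute (T a) (T b))
    (χ : t → ℂ) {v : V} (hv : v ≠ 0) (h : ∀ a, ∃ k : ℕ, ((T a - χ a • (1 : Module.End ℂ V)) ^ k) v = 0) :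
    ∃ μ : Module.Dual ℂ t, ∀ a, μ a = χ a := by
  have hc : ∀ (a b : t) (c d : ℂ), Commute (T a - c • (1 : Module.End ℂ V))
      (T b - d • (1 : Module.End ℂ V)) := fun a b c d =>
    (((hT a b).sub_right ((Commute.one_right _).smul_right _))).sub_left
      ((Commute.one_left _).smul_left _)
  refine ⟨{ toFun := χ, map_add' := fun a b => ?_, map_smul' := fun c a => ?_ }, fun _ => rfl⟩
  · obtain ⟨k, hk⟩ := h a
    obtain ⟨l, hl⟩ := h b
    obtain ⟨m, hm⟩ := h (a + b)
    have h1 := exists_pow_add (hc a b _ _) hk hl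
    have hm' : ((-(T (a + b) - χ (a + b) • (1 : Module.End ℂ V))) ^ m) v = 0 := by
      rw [neg_pow]
      simp only [Module.End.mul_apply, hm, map_zero]
    have hcomm : Commute (T a - χ a • (1 : Module.End ℂ V) + (T b - χ b • (1 : Module.End ℂ V)))
        (-(T (a + b) - χ (a + b) • (1 : Module.End ℂ V))) :=
      ((hc a (a + b) _ _).add_left (hc b (a + b) _ _)).neg_right
    have h2 := exists_pow_add hcomm h1 hm'
    have := scalar_eq_zero (c := χ (a + b) - (χ a + χ b)) (fun w => by
      simp [add_smul, sub_smul]; abel) hv h2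
    exact sub_eq_zero.mp this
  · obtain ⟨k, hk⟩ := h a
    obtain ⟨m, hm⟩ := h (c • a)
    have hk' : ((-(c • (T a - χ a • (1 : Module.End ℂ V)))) ^ k) v = 0 := by
      rw [neg_pow, smul_pow]
      simp only [Module.End.mul_apply, LinearMap.smul_apply, hk, smul_zero, map_zero]
    have h2 := exists_pow_add (((hc (c • a) a _ _).smul_right c).neg_right) hm hk'
    have := scalar_eq_zero (c := c * χ a - χ (c • a)) (fun w => by
      simp [sub_smul, smul_sub, smul_smul]) hv h2
    simpa using (sub_eq_zero.mp this).symm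

theorem weightSpace_iSup [FiniteDimensional ℂ V] (T : t →ₗ[ℂ] Module.End ℂ V)
    (hT : ∀ a b, Commute (T a) (T b)) : ⨆ μ, weightSpace T μ = ⊤ := by
  have h := Module.End.iSup_iInf_maxGenEigenspace_eq_top_of_forall_mapsTo (fun a => T a)
    (fun i j φ => Module.End.mapsTo_maxGenEigenspace_of_comm (hT j i) φ)
    (fun a => Module.End.iSup_maxGenEigenspace_eq_top _)
  rw [eq_top_iff, ← h]
  refine iSup_le fun χ => ?_
  by_cases hb : (⨅ i, (T i).maxGenEigenspace (χ i)) = ⊥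
  · rw [hb]; exact bot_le
  · obtain ⟨v, hv, hv0⟩ := (Submodule.ne_bot_iff _).mp hb
    rw [Module.End.mem_iInf_maxGenEigenspace_iff] at hv
    obtain ⟨μ, hμ⟩ := weight_linear T hT χ hv0 hv
    refine le_trans (le_of_eq ?_) (le_iSup (weightSpace T) μ)
    simp [weightSpace, hμ]

theorem finite_weights [FiniteDimensional ℂ V] (T : t →ₗ[ℂ] Module.End ℂ V)
    (hT : ∀ a b, Commute (T a) (T b)) :
    (Function.support fun μ => (Module.finrank ℂ (weightSpace T μ) : ℤ)).Finite := by
  refine (WellFoundedGT.finite_ne_bot_of_iSupIndep (weightSpace_indep T hT)).subset ?_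
  intro μ hμ
  simp only [Function.mem_support, ne_eq, Nat.cast_eq_zero] at hμ
  intro hb
  apply hμ
  rw [hb]; simp

/-- The character `∑ dim V^μ e^μ`. -/
def character [FiniteDimensional ℂ V] (T : t →ₗ[ℂ] Module.End ℂ V)
    (hT : ∀ a b, Commute (T a) (T b)) : AddMonoidAlgebra ℤ (Module.Dual ℂ t) :=
  .ofCoeff (Finsupp.ofSupportFinite _ (finite_weights T hT))

theorem character_apply [FiniteDimensional ℂ V] (T : t →ₗ[ℂ] Module.End ℂ V)
    (hT : ∀ a b, Commute (T a) (T b)) (μ : Module.Dual ℂ t) :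
    (character T hT).coeff μ = Module.finrank ℂ (weightSpace T μ) := rfl

/-- Sum of coefficients. -/
def total {X : Type*} : (X →₀ ℤ) →+ ℤ := Finsupp.liftAddHom fun _ => AddMonoidHom.id ℤ

theorem total_character [FiniteDimensional ℂ V] (T : t →ₗ[ℂ] Module.End ℂ V)
    (hT : ∀ a b, Commute (T a) (T b)) :
    total (character T hT).coeff = Module.finrank ℂ V := by
  classical
  have hfin := WellFoundedGT.finite_ne_bot_of_iSupIndep (weightSpace_indep T hT)
  have hind : iSupIndep fun μ : hfin.toFinset => weightSpace T μ :=
    (weightSpace_indep T hT).comp Subtype.val_injective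
  have hsup : ⨆ μ : hfin.toFinset, weightSpace T μ = ⊤ := by
    rw [eq_top_iff, ← weightSpace_iSup T hT]
    refine iSup_le fun μ => ?_
    by_cases hb : weightSpace T μ = ⊥
    · rw [hb]; exact bot_le
    · exact le_iSup (fun μ : hfin.toFinset => weightSpace T μ) ⟨μ, by simpa using hb⟩
  have hint := DirectSum.isInternal_submodule_of_iSupIndep_of_iSup_eq_top hind hsup
  have e := LinearEquiv.ofBijective (DirectSum.coeLinearMap _) hint
  have h1 := e.finrank_eq
  rw [Module.finrank_directSum] at h1
  rw [← h1, Finset.sum_coe_sort hfin.toFinset (fun μ => Module.finrank ℂ (weightSpace T μ))]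
  simp only [total, Finsupp.liftAddHom_apply]
  rw [Finsupp.sum_of_support_subset (s := hfin.toFinset)]
  · simp [character_apply]
  · intro μ hμ
    simp only [Finsupp.mem_support_iff, ne_eq, character_apply] at hμ
    simp only [Set.Finite.mem_toFinset, Set.mem_ofPred_eq]
    intro hb
    apply hμ
    rw [hb]
    simp
  · simp

theorem eq_of_le_of_total {X : Type*} {f g : X →₀ ℤ} (h : ∀ x, f x ≤ g x)
    (ht : total g ≤ total f) : f = g := by
  classical
  have h0 : ∀ x, 0 ≤ (g - f) x := fun x => by simpa using h x
  have h1 : total (g - f) ≤ 0 := by rw [map_sub]; linarith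
  have h2 : (g - f) = 0 := by
    ext x
    simp only [total, Finsupp.liftAddHom_apply, AddMonoidHom.id_apply, Finsupp.sum] at h1
    by_contra hx
    have hx' : x ∈ (g - f).support := Finsupp.mem_support_iff.mpr hx
    have := Finset.single_le_sum (fun y _ => h0 y) hx'
    have h3 := h0 x
    have h4 : (g - f) x ≠ 0 := hx
    omega
  exact (sub_eq_zero.mp h2).symm

theorem intertwine_pow {T : Module.End ℂ V} {S : Module.End ℂ W} {f : V →ₗ[ℂ] W}
    (h : ∀ v, f (T v) = S (f v)) (c : ℂ) (k : ℕ) (v : V) :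
    f (((T - c • (1 : Module.End ℂ V)) ^ k) v) = ((S - c • (1 : Module.End ℂ W)) ^ k) (f v) := by
  induction k with
  | zero => simp
  | succ k ih => simp [pow_succ', Module.End.mul_apply, ← ih, h]

theorem character_exact [FiniteDimensional ℂ V] [FiniteDimensional ℂ W] [FiniteDimensional ℂ Q]
    {S : t →ₗ[ℂ] Module.End ℂ W} {T : t →ₗ[ℂ] Module.End ℂ V} {R : t →ₗ[ℂ] Module.End ℂ Q}
    (hS : ∀ a b, Commute (S a) (S b)) (hT : ∀ a b, Commute (T a) (T b))
    (hR : ∀ a b, Commute (R a) (R b))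
    (i : W →ₗ[ℂ] V) (p : V →ₗ[ℂ] Q) (hi : Function.Injective i) (hp : Function.Surjective p)
    (hip : LinearMap.range i = LinearMap.ker p)
    (hiS : ∀ a w, i (S a w) = T a (i w)) (hpT : ∀ a v, p (T a v) = R a (p v)) :
    character T hT = character S hS + character R hR := by
  apply AddMonoidAlgebra.coeff_injective
  rw [AddMonoidAlgebra.coeff_add]
  apply eq_of_le_of_total
  · intro μ
    simp only [Finsupp.coe_add, Pi.add_apply, character_apply]
    norm_cast
    have hmap : ∀ v ∈ weightSpace T μ, p v ∈ weightSpace R μ := by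
      intro v hv
      rw [mem_weightSpace] at hv ⊢
      intro a
      obtain ⟨k, hk⟩ := hv a
      exact ⟨k, by rw [← intertwine_pow (hpT a), hk, map_zero]⟩
    let q : weightSpace T μ →ₗ[ℂ] weightSpace R μ := p.restrict hmap
    have hr := LinearMap.finrank_range_add_finrank_ker q
    have h1 : Module.finrank ℂ (LinearMap.range q) ≤ Module.finrank ℂ (weightSpace R μ) :=
      Submodule.finrank_le _
    have h2 : Module.finrank ℂ (LinearMap.ker q) ≤ Module.finrank ℂ (weightSpace S μ) := by
      have hker : ((LinearMap.ker q).map (weightSpace T μ).subtype) ≤ (weightSpace S μ).map i := by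
        rintro _ ⟨v, hv, rfl⟩
        have hv0 : p v = 0 := by
          have := congrArg Subtype.val (LinearMap.mem_ker.mp hv)
          simpa [q] using this
        have hv1 : (v : V) ∈ LinearMap.range i := by rw [hip]; exact hv0
        obtain ⟨w, hw⟩ := hv1
        refine ⟨w, ?_, hw⟩
        rw [SetLike.mem_coe, mem_weightSpace]
        intro a
        obtain ⟨k, hk⟩ := (mem_weightSpace _ _ _).mp v.2 a
        refine ⟨k, hi ?_⟩
        rw [intertwine_pow (hiS a), hw, hk, map_zero]
      have := Submodule.finrank_mono hker
      rwa [← (Submodule.equivMapOfInjective i hi _).finrank_eq,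
        ← (Submodule.equivMapOfInjective _ (Submodule.subtype_injective _) _).finrank_eq] at this
    omega
  · rw [map_add, total_character, total_character, total_character]
    have h1 := LinearMap.finrank_range_add_finrank_ker p
    rw [← hip, LinearMap.range_eq_top.mpr hp, finrank_top, LinearMap.finrank_range_of_inj hi] at h1
    omega

theorem sum_finrank_le [FiniteDimensional ℂ V] {X : Type*} {U : X → Submodule ℂ V}
    (hU : iSupIndep U) (F : Finset X) (P : Submodule ℂ V) (hF : ∀ μ ∈ F, U μ ≤ P) :
    ∑ μ ∈ F, Module.finrank ℂ (U μ) ≤ Module.finrank ℂ P := by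
  classical
  have hind : iSupIndep fun μ : F => U μ := hU.comp Subtype.val_injective
  have hinj := hind.dfinsupp_lsum_injective
  rw [← Finset.sum_coe_sort F (fun μ => Module.finrank ℂ (U μ))]
  have h1 := Module.finrank_directSum (R := ℂ) (fun μ : F => U μ)
  rw [← h1]
  have h2 : LinearMap.range (DirectSum.coeLinearMap fun μ : F => U μ) ≤ P := by
    rw [DirectSum.range_coeLinearMap]
    exact iSup_le fun μ => hF μ μ.2
  rw [← LinearMap.finrank_range_of_inj
    (show Function.Injective (DirectSum.coeLinearMap fun μ : F => U μ) from hinj)]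
  exact Submodule.finrank_mono h2

theorem total_mapDomain {X Y : Type*} (f : X → Y) (x : X →₀ ℤ) :
    total (x.mapDomain f) = total x := by
  simp only [total, Finsupp.liftAddHom_apply]
  exact Finsupp.sum_mapDomain_index (by simp) (by simp)

theorem character_comp [FiniteDimensional ℂ V] (T : t →ₗ[ℂ] Module.End ℂ V)
    (hT : ∀ a b, Commute (T a) (T b)) (π : t' →ₗ[ℂ] t)
    (hT' : ∀ a b, Commute ((T ∘ₗ π) a) ((T ∘ₗ π) b)) :
    character (T ∘ₗ π) hT' = (character T hT).mapDomain π.dualMap := by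
  classical
  apply AddMonoidAlgebra.coeff_injective
  symm
  apply eq_of_le_of_total
  · intro ν
    have h1 : ((character T hT).mapDomain π.dualMap).coeff ν =
        ∑ μ ∈ (character T hT).coeff.support with π.dualMap μ = ν,
          (Module.finrank ℂ (weightSpace T μ) : ℤ) := by
      change (Finsupp.mapDomain π.dualMap (character T hT).coeff) ν = _
      rw [Finsupp.mapDomain, Finsupp.sum, Finsupp.finsetSum_apply, Finset.sum_filter]
      refine Finset.sum_congr rfl fun μ _ => ?_
      rw [Finsupp.single_apply, character_apply]
    rw [h1, character_apply]
    norm_cast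
    refine sum_finrank_le (weightSpace_indep T hT) _ _ fun μ hμ => ?_
    rw [Finset.mem_filter] at hμ
    intro v hv
    rw [mem_weightSpace] at hv ⊢
    intro a
    obtain ⟨k, hk⟩ := hv (π a)
    refine ⟨k, ?_⟩
    rw [← hμ.2]
    exact hk
  · change _ ≤ total (Finsupp.mapDomain π.dualMap (character T hT).coeff)
    rw [total_mapDomain, total_character, total_character]

/-- Restriction of functions along a linear map `π : t' → t`: the ring homomorphism
`e^μ ↦ e^(μ ∘ π)`. -/
def pullback (π : t' →ₗ[ℂ] t) :
    AddMonoidAlgebra ℤ (Module.Dual ℂ t) →+* AddMonoidAlgebra ℤ (Module.Dual ℂ t') :=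
  AddMonoidAlgebra.mapDomainRingHom ℤ π.dualMap.toAddMonoidHom

theorem pullback_character [FiniteDimensional ℂ V] (T : t →ₗ[ℂ] Module.End ℂ V)
    (hT : ∀ a b, Commute (T a) (T b)) (π : t' →ₗ[ℂ] t)
    (hT' : ∀ a b, Commute ((T ∘ₗ π) a) ((T ∘ₗ π) b)) :
    pullback π (character T hT) = character (T ∘ₗ π) hT' :=
  (character_comp T hT π hT').symm

theorem pullback_injective (π : t' →ₗ[ℂ] t) (hπ : Function.Surjective π) :
    Function.Injective (pullback π) :=
  AddMonoidAlgebra.mapDomain_injective (LinearMap.dualMap_injective_of_surjective hπ)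

/-- The action of `t` on an invariant subspace. -/
def subRep (T : t →ₗ[ℂ] Module.End ℂ V) (P : Submodule ℂ V) (hP : ∀ a, ∀ v ∈ P, T a v ∈ P) :
    t →ₗ[ℂ] Module.End ℂ P where
  toFun a := (T a).restrict (hP a)
  map_add' a b := by ext v; simp
  map_smul' c a := by ext v; simp

theorem subRep_comm (T : t →ₗ[ℂ] Module.End ℂ V) (hT : ∀ a b, Commute (T a) (T b))
    (P : Submodule ℂ V) (hP : ∀ a, ∀ v ∈ P, T a v ∈ P) (a b : t) :
    Commute (subRep T P hP a) (subRep T P hP b) := by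
  ext v
  exact congrArg (fun S : Module.End ℂ V => S v) (hT a b)

theorem character_homology [FiniteDimensional ℂ V] [FiniteDimensional ℂ W]
    (T : t →ₗ[ℂ] Module.End ℂ V) (S : t →ₗ[ℂ] Module.End ℂ W)
    (hT : ∀ a b, Commute (T a) (T b)) (hS : ∀ a b, Commute (S a) (S b))
    (d : V →ₗ[ℂ] W) (e : W →ₗ[ℂ] V) (hd : ∀ a v, d (T a v) = S a (d v))
    (he : ∀ a w, e (S a w) = T a (e w)) (hde : ∀ w, d (e w) = 0) (hed : ∀ v, e (d v) = 0)
    (R : t →ₗ[ℂ] Module.End ℂ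
      (LinearMap.ker d ⧸ (LinearMap.range e).submoduleOf (LinearMap.ker d)))
    (R' : t →ₗ[ℂ] Module.End ℂ
      (LinearMap.ker e ⧸ (LinearMap.range d).submoduleOf (LinearMap.ker e)))
    (hR : ∀ a b, Commute (R a) (R b)) (hR' : ∀ a b, Commute (R' a) (R' b))
    (hRT : ∀ a (v w : LinearMap.ker d), T a v = w →
      R a (Submodule.Quotient.mk v) = Submodule.Quotient.mk w)
    (hRS : ∀ a (v w : LinearMap.ker e), S a v = w →
      R' a (Submodule.Quotient.mk v) = Submodule.Quotient.mk w) :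
    character T hT - character S hS = character R hR - character R' hR' := by
  have kd : ∀ a, ∀ v ∈ LinearMap.ker d, T a v ∈ LinearMap.ker d := fun a v hv => by
    rw [LinearMap.mem_ker, hd, LinearMap.mem_ker.mp hv, map_zero]
  have ke : ∀ a, ∀ v ∈ LinearMap.ker e, S a v ∈ LinearMap.ker e := fun a v hv => by
    rw [LinearMap.mem_ker, he, LinearMap.mem_ker.mp hv, map_zero]
  have rd : ∀ a, ∀ v ∈ LinearMap.range d, S a v ∈ LinearMap.range d := by
    rintro a _ ⟨v, rfl⟩
    exact ⟨T a v, hd a v⟩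
  have re : ∀ a, ∀ v ∈ LinearMap.range e, T a v ∈ LinearMap.range e := by
    rintro a _ ⟨v, rfl⟩
    exact ⟨S a v, he a v⟩
  have h1 := character_exact (subRep_comm T hT _ kd) hT (subRep_comm S hS _ rd)
    (LinearMap.ker d).subtype d.rangeRestrict (Submodule.subtype_injective _)
    d.surjective_rangeRestrict (by simp) (fun _ _ => rfl)
    (fun a v => Subtype.ext (hd a v))
  have h2 := character_exact (subRep_comm S hS _ ke) hS (subRep_comm T hT _ re)
    (LinearMap.ker e).subtype e.rangeRestrict (Submodule.subtype_injective _)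
    e.surjective_rangeRestrict (by simp) (fun _ _ => rfl)
    (fun a v => Subtype.ext (he a v))
  have le1 : LinearMap.range e ≤ LinearMap.ker d := by
    rintro _ ⟨w, rfl⟩
    exact hde w
  have le2 : LinearMap.range d ≤ LinearMap.ker e := by
    rintro _ ⟨w, rfl⟩
    exact hed w
  have h3 := character_exact (subRep_comm T hT _ re) (subRep_comm T hT _ kd) hR
    (Submodule.inclusion le1) (Submodule.mkQ _) (Submodule.inclusion_injective le1)
    (Submodule.mkQ_surjective _)
    (by rw [Submodule.ker_mkQ, Submodule.range_inclusion]; rfl)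
    (fun _ _ => rfl) (fun a v => (hRT a v _ rfl).symm)
  have h4 := character_exact (subRep_comm S hS _ rd) (subRep_comm S hS _ ke) hR'
    (Submodule.inclusion le2) (Submodule.mkQ _) (Submodule.inclusion_injective le2)
    (Submodule.mkQ_surjective _)
    (by rw [Submodule.ker_mkQ, Submodule.range_inclusion]; rfl)
    (fun _ _ => rfl) (fun a v => (hRS a v _ rfl).symm)
  rw [h1, h2, h3, h4]
  abel

end Weights

section Descent

variable {V W U : Type*} [AddCommGroup V] [Module ℂ V] [AddCommGroup W] [Module ℂ W]
  [AddCommGroup U] [Module ℂ U]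

/-- The bilinear map `P/p × Q/q → R/r` induced by a bilinear map `V × W → U`. -/
def bilinSubquot (f : V →ₗ[ℂ] W →ₗ[ℂ] U) (P p : Submodule ℂ V) (Q q : Submodule ℂ W)
    (R r : Submodule ℂ U) (h : ∀ v ∈ P, ∀ w ∈ Q, f v w ∈ R)
    (h1 : ∀ v ∈ P, v ∈ p → ∀ w ∈ Q, f v w ∈ r)
    (h2 : ∀ v ∈ P, ∀ w ∈ Q, w ∈ q → f v w ∈ r) :
    (P ⧸ p.submoduleOf P) →ₗ[ℂ] (Q ⧸ q.submoduleOf Q) →ₗ[ℂ] (R ⧸ r.submoduleOf R) :=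
  (p.submoduleOf P).liftQ
    { toFun := fun v => (q.submoduleOf Q).mapQ (r.submoduleOf R)
        ((f v).restrict fun w hw => h v v.2 w hw) fun w hw => h2 v v.2 w w.2 hw
      map_add' := fun v v' => Submodule.linearMap_qext _ <| LinearMap.ext fun w =>
        congrArg (Submodule.Quotient.mk (p := r.submoduleOf R)) <| Subtype.ext <| by
          change f (v + v' : V) w = f v w + f v' w
          simp
      map_smul' := fun c v => Submodule.linearMap_qext _ <| LinearMap.ext fun w =>
        congrArg (Submodule.Quotient.mk (p := r.submoduleOf R)) <| Subtype.ext <| by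
          change f (c • v : V) w = c • f v w
          simp }
    (fun v hv => LinearMap.mem_ker.mpr <| Submodule.linearMap_qext _ <| LinearMap.ext fun w =>
      show Submodule.Quotient.mk (p := r.submoduleOf R) ⟨f v w, h v v.2 w w.2⟩ = 0 from
        (Submodule.Quotient.mk_eq_zero _).mpr (h1 v v.2 hv w w.2))

end Descent

/-- A complex Lie superalgebra `𝔤 = 𝔤₀ ⊕ 𝔤₁`: a Lie algebra `𝔤₀`, a `𝔤₀`-module `𝔤₁`
(`rep a x = [a, x]`), and the symmetric bracket `sq x y = [x, y]` of odd elements, subject to the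
super Jacobi identity. -/
structure LieSuperalgebra : Type (u + 1) where
  even : Type u
  odd : Type u
  [lieRing : LieRing even]
  [lieAlgebra : LieAlgebra ℂ even]
  [addCommGroup : AddCommGroup odd]
  [module : Module ℂ odd]
  rep : even →ₗ[ℂ] odd →ₗ[ℂ] odd
  sq : odd →ₗ[ℂ] odd →ₗ[ℂ] even
  rep_lie : ∀ a b x, rep ⁅a, b⁆ x = rep a (rep b x) - rep b (rep a x)
  sq_comm : ∀ x y, sq x y = sq y x
  lie_sq : ∀ a x y, ⁅a, sq x y⁆ = sq (rep a x) y + sq x (rep a y)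
  jacobi : ∀ x y z, rep (sq x y) z + rep (sq y z) x + rep (sq z x) y = 0

attribute [instance] LieSuperalgebra.lieRing LieSuperalgebra.lieAlgebra
  LieSuperalgebra.addCommGroup LieSuperalgebra.module

/-- A Lie superalgebra `𝔤` with a distinguished commutative subspace `𝔥 ⊆ 𝔤₀` (its Cartan
subalgebra), with respect to which weights are taken. -/
structure CartanPair : Type (u + 1) extends LieSuperalgebra.{u} where
  cartan : Submodule ℂ even
  cartan_comm : ∀ a ∈ cartan, ∀ b ∈ cartan, ⁅a, b⁆ = 0

/-- A finite-dimensional module `M = M₀ ⊕ M₁` over a Lie superalgebra. -/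
structure SuperModule (g : LieSuperalgebra.{u}) : Type (max u 1) where
  even : Type
  odd : Type
  [evenGroup : AddCommGroup even]
  [evenModule : Module ℂ even]
  [evenFinite : FiniteDimensional ℂ even]
  [oddGroup : AddCommGroup odd]
  [oddModule : Module ℂ odd]
  [oddFinite : FiniteDimensional ℂ odd]
  rep₀ : g.even →ₗ[ℂ] even →ₗ[ℂ] even
  rep₁ : g.even →ₗ[ℂ] odd →ₗ[ℂ] odd
  act₀ : g.odd →ₗ[ℂ] even →ₗ[ℂ] odd
  act₁ : g.odd →ₗ[ℂ] odd →ₗ[ℂ] even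
  rep₀_lie : ∀ a b m, rep₀ ⁅a, b⁆ m = rep₀ a (rep₀ b m) - rep₀ b (rep₀ a m)
  rep₁_lie : ∀ a b m, rep₁ ⁅a, b⁆ m = rep₁ a (rep₁ b m) - rep₁ b (rep₁ a m)
  act₀_rep : ∀ a x m, act₀ (g.rep a x) m = rep₁ a (act₀ x m) - act₀ x (rep₀ a m)
  act₁_rep : ∀ a x m, act₁ (g.rep a x) m = rep₀ a (act₁ x m) - act₁ x (rep₁ a m)
  rep₀_sq : ∀ x y m, rep₀ (g.sq x y) m = act₁ x (act₀ y m) + act₁ y (act₀ x m)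
  rep₁_sq : ∀ x y m, rep₁ (g.sq x y) m = act₀ x (act₁ y m) + act₀ y (act₁ x m)

attribute [instance] SuperModule.evenGroup SuperModule.evenModule SuperModule.evenFinite
  SuperModule.oddGroup SuperModule.oddModule SuperModule.oddFinite

namespace LieSuperalgebra

variable (g : LieSuperalgebra.{u}) (x : g.odd)

/-- The even part of the centraliser `𝔤^x`. -/
def evenCentralizer : LieSubalgebra ℂ g.even where
  __ := LinearMap.ker (g.rep.flip x)
  lie_mem' := by
    intro a b ha hb
    change g.rep a x = 0 at ha
    change g.rep b x = 0 at hb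
    change g.rep ⁅a, b⁆ x = 0
    simp [g.rep_lie, ha, hb]

theorem mem_evenCentralizer {a : g.even} : a ∈ g.evenCentralizer x ↔ g.rep a x = 0 := Iff.rfl

/-- The odd part of the centraliser `𝔤^x`. -/
def oddCentralizer : Submodule ℂ g.odd := LinearMap.ker (g.sq x)

theorem mem_oddCentralizer {v : g.odd} : v ∈ g.oddCentralizer x ↔ g.sq x v = 0 := Iff.rfl

/-- The odd part `[x, 𝔤₀]` of `[x, 𝔤]`. -/
def oddBoundary : Submodule ℂ g.odd := LinearMap.range (g.rep.flip x)

theorem mem_oddBoundary {v : g.odd} : v ∈ g.oddBoundary x ↔ ∃ c, g.rep c x = v := Iff.rfl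

/-- The even part `[x, 𝔤₁]` of `[x, 𝔤]`, as an ideal of the even part of `𝔤^x`. -/
def evenBoundary : LieIdeal ℂ (g.evenCentralizer x) where
  __ := (LinearMap.range (g.sq x)).submoduleOf (g.evenCentralizer x).toSubmodule
  lie_mem := by
    rintro ⟨b, hb⟩ ⟨a, ha⟩ ⟨v, hv⟩
    change g.sq x v = a at hv
    refine ⟨g.rep b v, ?_⟩
    change g.sq x (g.rep b v) = ⁅b, a⁆
    rw [← hv, g.lie_sq, (g.mem_evenCentralizer x).mp hb]
    simp

theorem mem_evenBoundary {a : g.evenCentralizer x} :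
    a ∈ g.evenBoundary x ↔ ∃ v, g.sq x v = a := Iff.rfl

theorem jacobi' (u v w : g.odd) : g.rep (g.sq u v) w = -g.rep (g.sq v w) u - g.rep (g.sq w u) v := by
  have := g.jacobi u v w
  rw [sub_eq_add_neg, eq_comm, neg_add_eq_iff_eq_add, eq_comm]
  rw [← sub_eq_zero, ← this]
  abel

/-- The Lie superalgebra `𝔤_x = 𝔤^x / [x, 𝔤]`, for an odd `x` with `[x, x] = 0`. -/
def ds (_hx : g.sq x x = 0) : LieSuperalgebra.{u} where
  even := g.evenCentralizer x ⧸ g.evenBoundary x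
  odd := g.oddCentralizer x ⧸ (g.oddBoundary x).submoduleOf (g.oddCentralizer x)
  rep := bilinSubquot g.rep (g.evenCentralizer x).toSubmodule
        (LinearMap.range (g.sq x)) (g.oddCentralizer x) (g.oddBoundary x) (g.oddCentralizer x)
        (g.oddBoundary x)
        (by
          intro a ha v hv
          have h := g.lie_sq a x v
          rw [(g.mem_oddCentralizer x).mp hv, (g.mem_evenCentralizer x).mp ha] at h
          simpa [mem_oddCentralizer] using h.symm)
        (by
          rintro _ ha ⟨u, rfl⟩ v hv
          refine ⟨-g.sq u v, ?_⟩
          have := g.jacobi' x u v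
          rw [g.sq_comm v x, (g.mem_oddCentralizer x).mp hv] at this
          simpa using this.symm)
        (by
          rintro a ha _ hv ⟨c, rfl⟩
          refine ⟨⁅a, c⁆, ?_⟩
          have := g.rep_lie a c x
          rw [(g.mem_evenCentralizer x).mp ha] at this
          simpa using this)
  rep_lie := by
    intro a b v
    induction a using Quotient.inductionOn' with | _ a
    induction b using Quotient.inductionOn' with | _ b
    induction v using Quotient.inductionOn' with | _ v
    exact congrArg (Submodule.Quotient.mk (p := (g.oddBoundary x).submoduleOf _))
      (Subtype.ext (g.rep_lie a b v))
  sq := bilinSubquot g.sq (g.oddCentralizer x) (g.oddBoundary x) (g.oddCentralizer x)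
        (g.oddBoundary x) (g.evenCentralizer x).toSubmodule (LinearMap.range (g.sq x))
        (by
          intro v hv w hw
          change g.rep (g.sq v w) x = 0
          rw [g.jacobi', g.sq_comm w x, (g.mem_oddCentralizer x).mp hv,
            (g.mem_oddCentralizer x).mp hw]
          simp)
        (by
          rintro _ hv ⟨c, rfl⟩ w hw
          refine ⟨-g.rep c w, ?_⟩
          have := g.lie_sq c x w
          rw [(g.mem_oddCentralizer x).mp hw] at this
          simp only [lie_zero] at this
          rw [map_neg]
          exact (eq_neg_of_add_eq_zero_left this.symm).symm)
        (by
          rintro v hv _ hw ⟨c, rfl⟩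
          refine ⟨-g.rep c v, ?_⟩
          have := g.lie_sq c x v
          rw [(g.mem_oddCentralizer x).mp hv] at this
          simp only [lie_zero] at this
          rw [map_neg, g.sq_comm v]
          exact (eq_neg_of_add_eq_zero_left this.symm).symm)
  sq_comm := by
    intro v w
    induction v using Quotient.inductionOn' with | _ v
    induction w using Quotient.inductionOn' with | _ w
    exact congrArg (Submodule.Quotient.mk (p := (g.evenBoundary x).toSubmodule))
      (Subtype.ext (g.sq_comm v w))
  lie_sq := by
    intro a v w
    induction a using Quotient.inductionOn' with | _ a
    induction v using Quotient.inductionOn' with | _ v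
    induction w using Quotient.inductionOn' with | _ w
    exact congrArg (Submodule.Quotient.mk (p := (g.evenBoundary x).toSubmodule))
      (Subtype.ext (g.lie_sq a v w))
  jacobi := by
    intro u v w
    induction u using Quotient.inductionOn' with | _ u
    induction v using Quotient.inductionOn' with | _ v
    induction w using Quotient.inductionOn' with | _ w
    exact congrArg (Submodule.Quotient.mk (p := (g.oddBoundary x).submoduleOf _))
      (Subtype.ext (g.jacobi u v w))

end LieSuperalgebra


namespace SuperModule

variable {g : LieSuperalgebra.{u}} (M : SuperModule g) (x : g.odd)

theorem act₁_act₀ (hx : g.sq x x = 0) (m : M.even) : M.act₁ x (M.act₀ x m) = 0 := by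
  have h := M.rep₀_sq x x m
  rw [hx, map_zero, LinearMap.zero_apply, ← two_smul ℂ] at h
  exact (smul_eq_zero.mp h.symm).resolve_left two_ne_zero

theorem act₀_act₁ (hx : g.sq x x = 0) (m : M.odd) : M.act₀ x (M.act₁ x m) = 0 := by
  have h := M.rep₁_sq x x m
  rw [hx, map_zero, LinearMap.zero_apply, ← two_smul ℂ] at h
  exact (smul_eq_zero.mp h.symm).resolve_left two_ne_zero

/-- The `𝔤_x`-module `M_x = Ker_M x / x M`. -/
def ds (hx : g.sq x x = 0) : SuperModule (g.ds x hx) where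
  even := LinearMap.ker (M.act₀ x) ⧸ (LinearMap.range (M.act₁ x)).submoduleOf _
  odd := LinearMap.ker (M.act₁ x) ⧸ (LinearMap.range (M.act₀ x)).submoduleOf _
  rep₀ := bilinSubquot M.rep₀ (g.evenCentralizer x).toSubmodule (LinearMap.range (g.sq x))
    (LinearMap.ker (M.act₀ x)) (LinearMap.range (M.act₁ x))
    (LinearMap.ker (M.act₀ x)) (LinearMap.range (M.act₁ x))
    (by
      intro a ha m hm
      have h := M.act₀_rep a x m
      rw [(g.mem_evenCentralizer x).mp ha, LinearMap.mem_ker.mp hm] at h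
      simpa using h)
    (by
      rintro _ ha ⟨u, rfl⟩ m hm
      refine ⟨M.act₀ u m, ?_⟩
      rw [M.rep₀_sq, LinearMap.mem_ker.mp hm, map_zero, add_zero])
    (by
      rintro a ha _ hm ⟨n, rfl⟩
      refine ⟨M.rep₁ a n, ?_⟩
      have h := M.act₁_rep a x n
      rw [(g.mem_evenCentralizer x).mp ha, map_zero, LinearMap.zero_apply] at h
      exact (sub_eq_zero.mp h.symm).symm)
  rep₁ := bilinSubquot M.rep₁ (g.evenCentralizer x).toSubmodule (LinearMap.range (g.sq x))
    (LinearMap.ker (M.act₁ x)) (LinearMap.range (M.act₀ x))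
    (LinearMap.ker (M.act₁ x)) (LinearMap.range (M.act₀ x))
    (by
      intro a ha m hm
      have h := M.act₁_rep a x m
      rw [(g.mem_evenCentralizer x).mp ha, LinearMap.mem_ker.mp hm] at h
      simpa using h)
    (by
      rintro _ ha ⟨u, rfl⟩ m hm
      refine ⟨M.act₁ u m, ?_⟩
      rw [M.rep₁_sq, LinearMap.mem_ker.mp hm, map_zero, add_zero])
    (by
      rintro a ha _ hm ⟨n, rfl⟩
      refine ⟨M.rep₀ a n, ?_⟩
      have h := M.act₀_rep a x n
      rw [(g.mem_evenCentralizer x).mp ha, map_zero, LinearMap.zero_apply] at h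
      exact (sub_eq_zero.mp h.symm).symm)
  act₀ := bilinSubquot M.act₀ (g.oddCentralizer x) (g.oddBoundary x)
    (LinearMap.ker (M.act₀ x)) (LinearMap.range (M.act₁ x))
    (LinearMap.ker (M.act₁ x)) (LinearMap.range (M.act₀ x))
    (by
      intro v hv m hm
      have h := M.rep₀_sq x v m
      rw [(g.mem_oddCentralizer x).mp hv, LinearMap.mem_ker.mp hm] at h
      simpa using h.symm)
    (by
      rintro _ hv ⟨c, rfl⟩ m hm
      refine ⟨-M.rep₀ c m, ?_⟩
      have h := M.act₀_rep c x m
      rw [LinearMap.mem_ker.mp hm, map_zero, zero_sub] at h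
      rw [map_neg]
      exact h.symm)
    (by
      rintro v hv _ hm ⟨n, rfl⟩
      refine ⟨-M.act₁ v n, ?_⟩
      have h := M.rep₁_sq x v n
      rw [(g.mem_oddCentralizer x).mp hv, map_zero, LinearMap.zero_apply] at h
      rw [map_neg]
      exact neg_eq_of_add_eq_zero_right h.symm)
  act₁ := bilinSubquot M.act₁ (g.oddCentralizer x) (g.oddBoundary x)
    (LinearMap.ker (M.act₁ x)) (LinearMap.range (M.act₀ x))
    (LinearMap.ker (M.act₀ x)) (LinearMap.range (M.act₁ x))
    (by
      intro v hv m hm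
      have h := M.rep₁_sq x v m
      rw [(g.mem_oddCentralizer x).mp hv, LinearMap.mem_ker.mp hm] at h
      simpa using h.symm)
    (by
      rintro _ hv ⟨c, rfl⟩ m hm
      refine ⟨-M.rep₁ c m, ?_⟩
      have h := M.act₁_rep c x m
      rw [LinearMap.mem_ker.mp hm, map_zero, zero_sub] at h
      rw [map_neg]
      exact h.symm)
    (by
      rintro v hv _ hm ⟨n, rfl⟩
      refine ⟨-M.act₀ v n, ?_⟩
      have h := M.rep₀_sq x v n
      rw [(g.mem_oddCentralizer x).mp hv, map_zero, LinearMap.zero_apply] at h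
      rw [map_neg]
      exact neg_eq_of_add_eq_zero_right h.symm)
  rep₀_lie := by
    intro a b m
    induction a using Quotient.inductionOn' with | _ a
    induction b using Quotient.inductionOn' with | _ b
    induction m using Quotient.inductionOn' with | _ m
    exact congrArg (Submodule.Quotient.mk (p := (LinearMap.range (M.act₁ x)).submoduleOf _))
      (Subtype.ext (M.rep₀_lie a b m))
  rep₁_lie := by
    intro a b m
    induction a using Quotient.inductionOn' with | _ a
    induction b using Quotient.inductionOn' with | _ b
    induction m using Quotient.inductionOn' with | _ m
    exact congrArg (Submodule.Quotient.mk (p := (LinearMap.range (M.act₀ x)).submoduleOf _))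
      (Subtype.ext (M.rep₁_lie a b m))
  act₀_rep := by
    intro a v m
    induction a using Quotient.inductionOn' with | _ a
    induction v using Quotient.inductionOn' with | _ v
    induction m using Quotient.inductionOn' with | _ m
    exact congrArg (Submodule.Quotient.mk (p := (LinearMap.range (M.act₀ x)).submoduleOf _))
      (Subtype.ext (M.act₀_rep a v m))
  act₁_rep := by
    intro a v m
    induction a using Quotient.inductionOn' with | _ a
    induction v using Quotient.inductionOn' with | _ v
    induction m using Quotient.inductionOn' with | _ m
    exact congrArg (Submodule.Quotient.mk (p := (LinearMap.range (M.act₁ x)).submoduleOf _))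
      (Subtype.ext (M.act₁_rep a v m))
  rep₀_sq := by
    intro v w m
    induction v using Quotient.inductionOn' with | _ v
    induction w using Quotient.inductionOn' with | _ w
    induction m using Quotient.inductionOn' with | _ m
    exact congrArg (Submodule.Quotient.mk (p := (LinearMap.range (M.act₁ x)).submoduleOf _))
      (Subtype.ext (M.rep₀_sq v w m))
  rep₁_sq := by
    intro v w m
    induction v using Quotient.inductionOn' with | _ v
    induction w using Quotient.inductionOn' with | _ w
    induction m using Quotient.inductionOn' with | _ m
    exact congrArg (Submodule.Quotient.mk (p := (LinearMap.range (M.act₀ x)).submoduleOf _))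
      (Subtype.ext (M.rep₁_sq v w m))

end SuperModule

namespace CartanPair

/-- The class in `𝔤_x` of an even element of `𝔤^x`. -/
def evenClass (g : CartanPair.{u}) (x : g.odd) (hx : g.sq x x = 0) (a : g.even)
    (ha : g.rep a x = 0) : (g.toLieSuperalgebra.ds x hx).even :=
  LieSubmodule.Quotient.mk (N := g.evenBoundary x) ⟨a, ha⟩

/-- The class in `𝔤_x` of an odd element of `𝔤^x`. -/
def oddClass (g : CartanPair.{u}) (x : g.odd) (hx : g.sq x x = 0) (v : g.odd)
    (hv : g.sq x v = 0) : (g.toLieSuperalgebra.ds x hx).odd :=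
  Submodule.Quotient.mk (p := (g.oddBoundary x).submoduleOf (g.oddCentralizer x)) ⟨v, hv⟩

/-- `𝔥 ∩ 𝔤^x`. -/
def cartanCentralizer (g : CartanPair.{u}) (x : g.odd) : Submodule ℂ (g.evenCentralizer x) :=
  g.cartan.submoduleOf (g.evenCentralizer x).toSubmodule

/-- `𝔤_x` with its distinguished subspace `𝔥_x`, the image of `𝔥 ∩ 𝔤^x`. -/
def ds (g : CartanPair.{u}) (x : g.odd) (hx : g.sq x x = 0) : CartanPair.{u} where
  toLieSuperalgebra := g.toLieSuperalgebra.ds x hx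
  cartan := (g.cartanCentralizer x).map (g.evenBoundary x).toSubmodule.mkQ
  cartan_comm := by
    rintro _ ⟨a, ha, rfl⟩ _ ⟨b, hb, rfl⟩
    have h : ⁅a, b⁆ = 0 := Subtype.ext (g.cartan_comm a ha b hb)
    change LieSubmodule.Quotient.mk (N := g.evenBoundary x) ⁅a, b⁆ = 0
    rw [h]
    rfl

variable {g : CartanPair.{u}}

theorem rep₀_comm (M : SuperModule g.toLieSuperalgebra) (a b : g.cartan) :
    Commute ((M.rep₀ ∘ₗ g.cartan.subtype) a : Module.End ℂ M.even)
      ((M.rep₀ ∘ₗ g.cartan.subtype) b) := by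
  ext m
  have h := M.rep₀_lie a b m
  rw [g.cartan_comm a a.2 b b.2, map_zero, LinearMap.zero_apply] at h
  exact sub_eq_zero.mp h.symm

theorem rep₁_comm (M : SuperModule g.toLieSuperalgebra) (a b : g.cartan) :
    Commute ((M.rep₁ ∘ₗ g.cartan.subtype) a : Module.End ℂ M.odd)
      ((M.rep₁ ∘ₗ g.cartan.subtype) b) := by
  ext m
  have h := M.rep₁_lie a b m
  rw [g.cartan_comm a a.2 b b.2, map_zero, LinearMap.zero_apply] at h
  exact sub_eq_zero.mp h.symm

/-- The supercharacter `sch M = ∑ (dim M₀^μ - dim M₁^μ) e^μ`, in the group ring of `𝔥^*`. -/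
def sch (M : SuperModule g.toLieSuperalgebra) : AddMonoidAlgebra ℤ (Module.Dual ℂ g.cartan) :=
  character (V := M.even) (M.rep₀ ∘ₗ g.cartan.subtype) (rep₀_comm M) -
    character (V := M.odd) (M.rep₁ ∘ₗ g.cartan.subtype) (rep₁_comm M)

variable (g) in
/-- The homomorphism `[M] ↦ sch M` from the free abelian group on the finite-dimensional
`𝔤`-modules. -/
def schHom : FreeAbelianGroup (SuperModule g.toLieSuperalgebra) →+
    AddMonoidAlgebra ℤ (Module.Dual ℂ g.cartan) :=
  FreeAbelianGroup.lift sch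

variable (g) in
/-- The supercharacter ring `J_𝔤`: the image of `sch` in `ℤ[𝔥^*]`, as an additive group. (It is
closed under products because tensor products of finite-dimensional modules exist.) -/
def J : AddSubgroup (AddMonoidAlgebra ℤ (Module.Dual ℂ g.cartan)) := (schHom g).range

/-- The class `[M] ∈ J_𝔤`. -/
def cls (M : SuperModule g.toLieSuperalgebra) : J g :=
  ⟨sch M, FreeAbelianGroup.of M, FreeAbelianGroup.lift_apply_of _ _⟩

section WellDefined

variable (x : g.odd) (hx : g.sq x x = 0)

/-- The inclusion `𝔥 ∩ 𝔤^x → 𝔥`. -/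
def toCartan : g.cartanCentralizer x →ₗ[ℂ] g.cartan where
  toFun a := ⟨a.1.1, a.2⟩
  map_add' _ _ := rfl
  map_smul' _ _ := rfl

/-- The projection `𝔥 ∩ 𝔤^x → 𝔥_x`. -/
def toCartanDS : g.cartanCentralizer x →ₗ[ℂ] (g.ds x hx).cartan where
  toFun a := ⟨(g.evenBoundary x).toSubmodule.mkQ a, a.1, a.2, rfl⟩
  map_add' _ _ := rfl
  map_smul' _ _ := rfl

theorem toCartanDS_surjective : Function.Surjective (toCartanDS x hx) := by
  rintro ⟨_, a, ha, rfl⟩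
  exact ⟨⟨a, ha⟩, rfl⟩

theorem pullback_sch (M : SuperModule g.toLieSuperalgebra) :
    pullback (toCartan x) (sch M) = pullback (toCartanDS x hx) (sch (g := g.ds x hx) (M.ds x hx)) := by
  have c1 := fun a b => rep₀_comm M (toCartan x a) (toCartan x b)
  have c2 := fun a b => rep₁_comm M (toCartan x a) (toCartan x b)
  have c3 := fun a b => rep₀_comm (g := g.ds x hx) (M.ds x hx) (toCartanDS x hx a)
    (toCartanDS x hx b)
  have c4 := fun a b => rep₁_comm (g := g.ds x hx) (M.ds x hx) (toCartanDS x hx a)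
    (toCartanDS x hx b)
  unfold sch
  rw [map_sub, map_sub, pullback_character _ _ _ c1, pullback_character _ _ _ c2,
    pullback_character _ _ _ c3, pullback_character _ _ _ c4]
  refine character_homology _ _ c1 c2 (M.act₀ x) (M.act₁ x) ?_ ?_ (M.act₀_act₁ x hx)
    (M.act₁_act₀ x hx) _ _ c3 c4 ?_ ?_
  · intro a m
    have h := M.act₀_rep a.1.1 x m
    rw [(g.mem_evenCentralizer x).mp a.1.2, map_zero, LinearMap.zero_apply] at h
    exact (sub_eq_zero.mp h.symm).symm
  · intro a m
    have h := M.act₁_rep a.1.1 x m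
    rw [(g.mem_evenCentralizer x).mp a.1.2, map_zero, LinearMap.zero_apply] at h
    exact (sub_eq_zero.mp h.symm).symm
  · intro a v w h
    exact congrArg Submodule.Quotient.mk (Subtype.ext h)
  · intro a v w h
    exact congrArg Submodule.Quotient.mk (Subtype.ext h)

/-- `[M] ↦ [DS_x M]`, on the free abelian group on the finite-dimensional `𝔤`-modules. -/
def dsFree : FreeAbelianGroup (SuperModule g.toLieSuperalgebra) →+ J (g.ds x hx) :=
  FreeAbelianGroup.lift fun M => cls (g := g.ds x hx) (M.ds x hx)

theorem pullback_schHom (m : FreeAbelianGroup (SuperModule g.toLieSuperalgebra)) :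
    pullback (toCartan x) (schHom g m) = pullback (toCartanDS x hx) (dsFree x hx m : _) := by
  induction m using FreeAbelianGroup.induction_on with
  | zero => simp
  | of M => simpa [schHom, dsFree, cls] using pullback_sch x hx M
  | neg M ih => simpa using ih
  | add a b ha hb => simp [ha, hb]

theorem ker_le : (schHom g).rangeRestrict.ker ≤ (dsFree x hx).ker := by
  intro m hm
  have h0 : schHom g m = 0 := congrArg Subtype.val (AddMonoidHom.mem_ker.mp hm)
  have h := pullback_schHom x hx m
  rw [h0, map_zero] at h
  rw [AddMonoidHom.mem_ker]
  apply Subtype.ext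
  apply pullback_injective _ (toCartanDS_surjective x hx)
  rw [← h]
  simp

/-- The homomorphism `ds_x : J_𝔤 → J_{𝔤_x}` determined by `[M] ↦ [DS_x M]` and extended
linearly; well-definedness is `ker_le`. -/
def dsHom : J g →+ J (g.ds x hx) :=
  (schHom g).rangeRestrict.liftOfSurjective (schHom g).rangeRestrict_surjective
    ⟨dsFree x hx, ker_le x hx⟩

theorem dsHom_cls (M : SuperModule g.toLieSuperalgebra) :
    dsHom x hx (cls M) = cls (g := g.ds x hx) (M.ds x hx) := by
  have h1 : cls M = (schHom g).rangeRestrict (FreeAbelianGroup.of M) :=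
    Subtype.ext (FreeAbelianGroup.lift_apply_of _ _).symm
  rw [h1, dsHom]
  have := AddMonoidHom.liftOfRightInverse_comp_apply (schHom g).rangeRestrict _
    (Function.rightInverse_surjInv (schHom g).rangeRestrict_surjective)
    ⟨dsFree x hx, ker_le x hx⟩ (FreeAbelianGroup.of M)
  exact this.trans (FreeAbelianGroup.lift_apply_of _ _)

end WellDefined

section Iterate

variable {k : ℕ}

theorem sq_sum (x : Fin k → g.odd) (hx : ∀ i j, g.sq (x i) (x j) = 0) :
    g.sq (∑ i, x i) (∑ i, x i) = 0 := by
  simp [map_sum, hx]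

theorem rep_sum (x : Fin k → g.odd) {a : g.even} (ha : ∀ i, g.rep a (x i) = 0) :
    g.rep a (∑ i, x i) = 0 := by
  simp [map_sum, ha]

theorem sq_sum_left (x : Fin k → g.odd) {v : g.odd} (hv : ∀ i, g.sq (x i) v = 0) :
    g.sq (∑ i, x i) v = 0 := by
  simp [map_sum, hv]

/-- For pairwise supercommuting odd `x₁, …, x_{k+1}`, the classes of `x₁, …, x_k` in
`𝔤_{x_{k+1}}`. -/
def descend (x : Fin (k + 1) → g.odd) (hx : ∀ i j, g.sq (x i) (x j) = 0) (i : Fin k) :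
    (g.ds (x (Fin.last k)) (hx _ _)).odd :=
  g.oddClass _ (hx _ _) (x i.castSucc) (hx _ _)

theorem descend_sq (x : Fin (k + 1) → g.odd) (hx : ∀ i j, g.sq (x i) (x j) = 0) (i j : Fin k) :
    (g.ds (x (Fin.last k)) (hx _ _)).sq (descend x hx i) (descend x hx j) = 0 :=
  congrArg (Submodule.Quotient.mk (p := (g.evenBoundary _).toSubmodule))
    (Subtype.ext (hx i.castSucc j.castSucc) :
      (⟨g.sq (x i.castSucc) (x j.castSucc), _⟩ : g.evenCentralizer (x (Fin.last k))) = 0)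

theorem descend_rep (x : Fin (k + 1) → g.odd) (hx : ∀ i j, g.sq (x i) (x j) = 0) (a : g.even)
    (ha : ∀ i, g.rep a (x i) = 0) (i : Fin k) :
    (g.ds (x (Fin.last k)) (hx _ _)).rep (g.evenClass _ (hx _ _) a (ha _)) (descend x hx i) = 0 :=
  congrArg (Submodule.Quotient.mk (p := (g.oddBoundary _).submoduleOf _))
    (Subtype.ext (ha i.castSucc) :
      (⟨g.rep a (x i.castSucc), _⟩ : g.oddCentralizer (x (Fin.last k))) = 0)

theorem descend_sq_left (x : Fin (k + 1) → g.odd) (hx : ∀ i j, g.sq (x i) (x j) = 0) (v : g.odd)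
    (hv : ∀ i, g.sq (x i) v = 0) (i : Fin k) :
    (g.ds (x (Fin.last k)) (hx _ _)).sq (descend x hx i) (g.oddClass _ (hx _ _) v (hv _)) = 0 :=
  congrArg (Submodule.Quotient.mk (p := (g.evenBoundary _).toSubmodule))
    (Subtype.ext (hv i.castSucc) :
      (⟨g.sq (x i.castSucc) v, _⟩ : g.evenCentralizer (x (Fin.last k))) = 0)

/-- The iterated algebra `(⋯((𝔤_{x_k})_{x_{k-1}})⋯)_{x₁}`. -/
def iter : (k : ℕ) → (g : CartanPair.{u}) → (x : Fin k → g.odd) →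
    (∀ i j, g.sq (x i) (x j) = 0) → CartanPair.{u}
  | 0, g, _, _ => g
  | k + 1, g, x, hx => iter k (g.ds (x (Fin.last k)) (hx _ _)) (descend x hx) (descend_sq x hx)

/-- The class in the iterated algebra of an even element commuting with all `x_i`. -/
def iterEven : (k : ℕ) → (g : CartanPair.{u}) → (x : Fin k → g.odd) →
    (hx : ∀ i j, g.sq (x i) (x j) = 0) → (a : g.even) → (∀ i, g.rep a (x i) = 0) →
    (iter k g x hx).even
  | 0, _, _, _, a, _ => a
  | k + 1, g, x, hx, a, ha => iterEven k (g.ds (x (Fin.last k)) (hx _ _)) (descend x hx)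
      (descend_sq x hx) (g.evenClass _ (hx _ _) a (ha _)) (descend_rep x hx a ha)

/-- The class in the iterated algebra of an odd element supercommuting with all `x_i`. -/
def iterOdd : (k : ℕ) → (g : CartanPair.{u}) → (x : Fin k → g.odd) →
    (hx : ∀ i j, g.sq (x i) (x j) = 0) → (v : g.odd) → (∀ i, g.sq (x i) v = 0) →
    (iter k g x hx).odd
  | 0, _, _, _, v, _ => v
  | k + 1, g, x, hx, v, hv => iterOdd k (g.ds (x (Fin.last k)) (hx _ _)) (descend x hx)
      (descend_sq x hx) (g.oddClass _ (hx _ _) v (hv _)) (descend_sq_left x hx v hv)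

/-- The composition `ds_{x₁} ∘ ⋯ ∘ ds_{x_k}`. -/
def dsComp : (k : ℕ) → (g : CartanPair.{u}) → (x : Fin k → g.odd) →
    (hx : ∀ i j, g.sq (x i) (x j) = 0) → J g →+ J (iter k g x hx)
  | 0, g, _, _ => AddMonoidHom.id (J g)
  | k + 1, g, x, hx => (dsComp k (g.ds (x (Fin.last k)) (hx _ _)) (descend x hx)
      (descend_sq x hx)).comp (dsHom (x (Fin.last k)) (hx _ _))

end Iterate

/-- An isomorphism of Lie superalgebras carrying the distinguished subspace `𝔥` onto `𝔥'`. -/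
structure Iso (g g' : CartanPair.{u}) where
  even : g.even ≃ₗ[ℂ] g'.even
  odd : g.odd ≃ₗ[ℂ] g'.odd
  map_lie : ∀ a b, even ⁅a, b⁆ = ⁅even a, even b⁆
  map_rep : ∀ a v, odd (g.rep a v) = g'.rep (even a) (odd v)
  map_sq : ∀ v w, even (g.sq v w) = g'.sq (odd v) (odd w)
  map_cartan : g.cartan.map (even : g.even →ₗ[ℂ] g'.even) = g'.cartan

/-- The induced isomorphism `𝔥 ≃ 𝔥'`. -/
def Iso.cartanEquiv {g g' : CartanPair.{u}} (Φ : Iso g g') : g.cartan ≃ₗ[ℂ] g'.cartan :=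
  Φ.even.ofSubmodules _ _ Φ.map_cartan

/-- The identification `ℤ[𝔥^*] → ℤ[𝔥'^*]`, `e^μ ↦ e^(μ ∘ φ⁻¹)`, where `φ : 𝔥 ≃ 𝔥'`. -/
def Iso.transport {g g' : CartanPair.{u}} (Φ : Iso g g') :
    AddMonoidAlgebra ℤ (Module.Dual ℂ g.cartan) →+*
      AddMonoidAlgebra ℤ (Module.Dual ℂ g'.cartan) :=
  pullback (Φ.cartanEquiv.symm : g'.cartan →ₗ[ℂ] g.cartan)

section Roots

variable (g)

/-- `{a ∈ 𝔤₀ | [h, a] = α(h) a for all h ∈ 𝔥}`. -/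
def evenRootSpace (α : Module.Dual ℂ g.cartan) : Submodule ℂ g.even where
  carrier := {a | ∀ h : g.cartan, ⁅(h : g.even), a⁆ = α h • a}
  zero_mem' := by simp
  add_mem' := by
    intro a b ha hb h
    rw [lie_add, ha h, hb h, smul_add]
  smul_mem' := by
    intro c a ha h
    rw [lie_smul, ha h, smul_comm]

/-- `{v ∈ 𝔤₁ | [h, v] = α(h) v for all h ∈ 𝔥}`. -/
def oddRootSpace (α : Module.Dual ℂ g.cartan) : Submodule ℂ g.odd where
  carrier := {v | ∀ h : g.cartan, g.rep h v = α h • v}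
  zero_mem' := by simp
  add_mem' := by
    intro a b ha hb h
    rw [map_add, ha h, hb h, smul_add]
  smul_mem' := by
    intro c a ha h
    rw [map_smul, ha h, smul_comm]

/-- `𝔤` is finite-dimensional with reductive even part (the adjoint representation of `𝔤₀` is
completely reducible), `𝔥` is a Cartan subalgebra, and there is a root space decomposition
`𝔤 = 𝔥 ⊕ ⨁_{α ≠ 0} 𝔤_α`. -/
structure IsReductivePair : Prop where
  finite_even : FiniteDimensional ℂ g.even
  finite_odd : FiniteDimensional ℂ g.odd
  reductive : ComplementedLattice (LieIdeal ℂ g.even)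
  even_zero : g.evenRootSpace 0 = g.cartan
  odd_zero : g.oddRootSpace 0 = ⊥
  iSup_even : ⨆ α, g.evenRootSpace α = ⊤
  iSup_odd : ⨆ α, g.oddRootSpace α = ⊤

/-- A nondegenerate even supersymmetric invariant bilinear form on `𝔤`. The two invariance
identities imply the remaining ones by (super)symmetry. -/
structure InvariantForm where
  even : LinearMap.BilinForm ℂ g.even
  odd : LinearMap.BilinForm ℂ g.odd
  even_symm : ∀ a b, even a b = even b a
  odd_skew : ∀ v w, odd v w = -odd w v
  even_invariant : ∀ a b c, even ⁅a, b⁆ c = even a ⁅b, c⁆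
  odd_invariant : ∀ a v w, odd (g.rep a v) w = even a (g.sq v w)
  even_nondegenerate : ∀ a, (∀ b, even a b = 0) → a = 0
  odd_nondegenerate : ∀ v, (∀ w, odd v w = 0) → v = 0

variable {g}

/-- `(α, β) = 0` for the form on `𝔥^*` induced by the form on `𝔥`: `(α, β) = β(t_α)`, where
`t_α ∈ 𝔥` represents `α`, that is `(t_α, h) = α(h)` for all `h ∈ 𝔥`. -/
def InvariantForm.Orthogonal (F : InvariantForm g) (α β : Module.Dual ℂ g.cartan) : Prop :=
  ∃ t : g.cartan, (∀ h : g.cartan, F.even t h = α h) ∧ β t = 0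

/-- `β` is an isotropic (odd) root. -/
structure InvariantForm.IsIsotropicRoot (F : InvariantForm g) (β : Module.Dual ℂ g.cartan) :
    Prop where
  ne_zero : β ≠ 0
  odd_root : g.oddRootSpace β ≠ ⊥
  isotropic : F.Orthogonal β β

/-- `{β₁, …, β_k} ∈ S_𝔤`: linearly independent, mutually orthogonal isotropic roots. -/
structure InvariantForm.IsIsotropicSystem (F : InvariantForm g) {k : ℕ}
    (β : Fin k → Module.Dual ℂ g.cartan) : Prop where
  root : ∀ i, F.IsIsotropicRoot (β i)
  orthogonal : ∀ i j, i ≠ j → F.Orthogonal (β i) (β j)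
  independent : LinearIndependent ℂ β

end Roots

end CartanPair

end DufloSerganova

end

/-! Write Dᵢ for the bracket with xᵢ. The Dᵢ are anticommuting differentials: 𝔤_x is the homology of
D = ∑ Dᵢ, while 𝔤' takes homology with respect to the Dᵢ one after another. For general
anticommuting differentials the two can differ. They agree here because of a `Contraction`: maps π
and sᵢ with 1 = π + ∑ (Dᵢsᵢ + sᵢDᵢ) and πDᵢ = Dᵢπ = 0, where sᵢ anticommutes with Dⱼ for j ≠ i.

With s = ∑ sᵢ the cross terms cancel and 1 = π + Ds + sD. Hence every class in 𝔤_x has a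
representative πa in ⋂ 𝔤^{xᵢ}, and it vanishes exactly when πa = 0 (`evenClass_sum_eq_zero_iff`). A
contraction descends to 𝔤_{x_k}, so induction gives the same description of 𝔤'
(`iterEven_eq_zero_iff`, `exists_iterEven`). Both algebras are therefore the quotient of ⋂ 𝔤^{xᵢ} by
the kernel of π on it, which gives Φ. Both sides of the supercharacter identity, pulled back to 𝔥 ∩
⋂ 𝔤^{xᵢ}, become the restriction of f; this space maps onto 𝔥', so they are equal (`transport_iso`).

To build a contraction (`nonempty_contraction`), take yᵢ of weight -βᵢ dual to xᵢ, tᵢ = [xᵢ, yᵢ],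
and hᵢ ∈ 𝔥 dual to the βᵢ. On root spaces where some α(tᵢ) ≠ 0, suitable multiples of the brackets
with yᵢ contract everything. Where all α(tᵢ) vanish, each Dⱼ has rank at most one, and only hᵢ, xᵢ,
yᵢ, tᵢ remain to be contracted by hand. This rank bound is where reductivity enters: even roots are
not isotropic (`even_eq_zero_of_isotropic`), and an 𝔰𝔩₂ root-string argument (`no_root_string`)
kills the brackets of xⱼ with other orthogonal root vectors. Non-isotropy of even roots also gives
[xᵢ, xⱼ] = 0. -/

noncomputable section

namespace DufloSerganova

/-! ### Linear maps between subquotients. -/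

section Linear

variable {V W A B C : Type*} [AddCommGroup V] [Module ℂ V] [AddCommGroup W] [Module ℂ W]
  [AddCommGroup A] [Module ℂ A] [AddCommGroup B] [Module ℂ B] [AddCommGroup C] [Module ℂ C]

/-- The linear map `P/p → Q/q` induced by a linear map `V → W`. -/
def subquotMap (f : V →ₗ[ℂ] W) (P p : Submodule ℂ V) (Q q : Submodule ℂ W)
    (h : ∀ v ∈ P, f v ∈ Q) (h' : ∀ v ∈ P, v ∈ p → f v ∈ q) :
    (P ⧸ p.submoduleOf P) →ₗ[ℂ] (Q ⧸ q.submoduleOf Q) :=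
  Submodule.mapQ _ _ (f.restrict h) (fun v hv => h' v v.2 hv)

/-- Two surjections with the same kernel have isomorphic targets. -/
def equivOfKerEq (p : C →ₗ[ℂ] A) (q : C →ₗ[ℂ] B) (hp : Function.Surjective p)
    (hq : Function.Surjective q) (h : ∀ c, p c = 0 ↔ q c = 0) : A ≃ₗ[ℂ] B :=
  (p.quotKerEquivOfSurjective hp).symm ≪≫ₗ
    Submodule.quotEquivOfEq (LinearMap.ker p) (LinearMap.ker q) (Submodule.ext h) ≪≫ₗ
      q.quotKerEquivOfSurjective hq

theorem equivOfKerEq_apply (p : C →ₗ[ℂ] A) (q : C →ₗ[ℂ] B) (hp : Function.Surjective p)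
    (hq : Function.Surjective q) (h : ∀ c, p c = 0 ↔ q c = 0) (c : C) :
    equivOfKerEq p q hp hq h (p c) = q c := by
  have h1 : (p.quotKerEquivOfSurjective hp).symm (p c) = Submodule.Quotient.mk c := by
    rw [LinearEquiv.symm_apply_eq]
    rfl
  change q.quotKerEquivOfSurjective hq (Submodule.quotEquivOfEq (LinearMap.ker p) (LinearMap.ker q)
    (Submodule.ext h) ((p.quotKerEquivOfSurjective hp).symm (p c))) = q c
  rw [h1]
  rfl

end Linear

/-! ### Contractions and their descent to 𝔤_{x_{k+1}}. -/

namespace CartanPair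

/-- A decomposition `1 = π + ∑ᵢ (Dᵢ sᵢ + sᵢ Dᵢ)` of the identity of `𝔤`, where `Dᵢ` is the bracket
with the odd element `xᵢ` (that is `a ↦ [a, xᵢ]` on `𝔤₀` and `v ↦ [xᵢ, v]` on `𝔤₁`), `π` is
annihilated by all `Dᵢ` on both sides and preserves `𝔥`, and `sᵢ` anticommutes with `Dⱼ` for
`j ≠ i`. -/
structure Contraction (g : CartanPair.{u}) {k : ℕ} (x : Fin k → g.odd) where
  projEven : g.even →ₗ[ℂ] g.even
  projOdd : g.odd →ₗ[ℂ] g.odd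
  homEven : Fin k → g.even →ₗ[ℂ] g.odd
  homOdd : Fin k → g.odd →ₗ[ℂ] g.even
  rep_projEven : ∀ a j, g.rep (projEven a) (x j) = 0
  sq_projOdd : ∀ v j, g.sq (x j) (projOdd v) = 0
  projOdd_rep : ∀ a j, projOdd (g.rep a (x j)) = 0
  projEven_sq : ∀ v j, projEven (g.sq (x j) v) = 0
  homotopyEven : ∀ a,
    a = projEven a + ∑ i, (g.sq (x i) (homEven i a) + homOdd i (g.rep a (x i)))
  homotopyOdd : ∀ v,
    v = projOdd v + ∑ i, (g.rep (homOdd i v) (x i) + homEven i (g.sq (x i) v))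
  anticommEven : ∀ i j, i ≠ j → ∀ a, g.sq (x j) (homEven i a) + homOdd i (g.rep a (x j)) = 0
  anticommOdd : ∀ i j, i ≠ j → ∀ v, g.rep (homOdd i v) (x j) + homEven i (g.sq (x j) v) = 0
  projEven_cartan : ∀ a ∈ g.cartan, projEven a ∈ g.cartan

namespace Contraction

variable {g : CartanPair.{u}}

theorem sq_mem_evenCentralizer {x y v : g.odd} (hxy : g.sq y x = 0) (hv : g.sq x v = 0) :
    g.sq y v ∈ g.evenCentralizer x := by
  rw [g.mem_evenCentralizer, g.jacobi', g.sq_comm v x, g.sq_comm x y, hxy, hv]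
  simp

theorem rep_mem_oddCentralizer {x y : g.odd} {a : g.even} (hxy : g.sq x y = 0)
    (ha : g.rep a x = 0) : g.rep a y ∈ g.oddCentralizer x := by
  have h := g.lie_sq a x y
  rw [hxy, ha] at h
  simpa [g.mem_oddCentralizer] using h.symm

/-- Anticommuting with Dⱼ, the homotopy sᵢ preserves the kernel of Dⱼ. This is half of what sᵢ needs
in order to act on 𝔤_{xⱼ}. -/
theorem homEven_mem {k : ℕ} {x : Fin k → g.odd} (c : Contraction g x) {i j : Fin k} (hij : i ≠ j)
    {a : g.even} (ha : g.rep a (x j) = 0) : g.sq (x j) (c.homEven i a) = 0 := by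
  simpa [ha] using c.anticommEven i j hij a

theorem homOdd_mem {k : ℕ} {x : Fin k → g.odd} (c : Contraction g x) {i j : Fin k} (hij : i ≠ j)
    {v : g.odd} (hv : g.sq (x j) v = 0) : g.rep (c.homOdd i v) (x j) = 0 := by
  simpa [hv] using c.anticommOdd i j hij v

/-- A contraction for `x₁, …, x_{k+1}` induces one for the classes of `x₁, …, x_k` in
`𝔤_{x_{k+1}}`. -/
def descend {k : ℕ} {x : Fin (k + 1) → g.odd} (c : Contraction g x)
    (hx : ∀ i j, g.sq (x i) (x j) = 0) :
    Contraction (g.ds (x (Fin.last k)) (hx _ _)) (CartanPair.descend x hx) where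
  projEven := subquotMap c.projEven (g.evenCentralizer (x (Fin.last k))).toSubmodule
    (LinearMap.range (g.sq (x (Fin.last k)))) (g.evenCentralizer (x (Fin.last k))).toSubmodule
    (LinearMap.range (g.sq (x (Fin.last k))))
    (fun a _ => c.rep_projEven a _)
    (by rintro _ - ⟨v, rfl⟩; rw [c.projEven_sq]; exact zero_mem _)
  projOdd := subquotMap c.projOdd (g.oddCentralizer (x (Fin.last k)))
    (g.oddBoundary (x (Fin.last k))) (g.oddCentralizer (x (Fin.last k)))
    (g.oddBoundary (x (Fin.last k)))
    (fun v _ => c.sq_projOdd v _)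
    (by
      rintro _ - ⟨a, rfl⟩
      have := c.projOdd_rep a (Fin.last k)
      rw [LinearMap.flip_apply, this]
      exact zero_mem _)
  homEven i := subquotMap (c.homEven i.castSucc)
    (g.evenCentralizer (x (Fin.last k))).toSubmodule
    (LinearMap.range (g.sq (x (Fin.last k)))) (g.oddCentralizer (x (Fin.last k)))
    (g.oddBoundary (x (Fin.last k)))
    (fun a ha => c.homEven_mem (Fin.castSucc_lt_last i).ne ha)
    (by
      rintro _ - ⟨v, rfl⟩
      -- The other half: anticommutation turns sᵢDv into -Dsᵢv, so boundaries go to boundaries.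
      have h := c.anticommOdd i.castSucc (Fin.last k) (Fin.castSucc_lt_last i).ne v
      exact ⟨-c.homOdd i.castSucc v, by
        rw [map_neg]; exact neg_eq_of_add_eq_zero_right h⟩)
  homOdd i := subquotMap (c.homOdd i.castSucc) (g.oddCentralizer (x (Fin.last k)))
    (g.oddBoundary (x (Fin.last k)))
    (g.evenCentralizer (x (Fin.last k))).toSubmodule
    (LinearMap.range (g.sq (x (Fin.last k))))
    (fun v hv => c.homOdd_mem (Fin.castSucc_lt_last i).ne hv)
    (by
      rintro _ - ⟨a, rfl⟩
      have h := c.anticommEven i.castSucc (Fin.last k) (Fin.castSucc_lt_last i).ne a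
      exact ⟨-c.homEven i.castSucc a, by
        rw [map_neg]; exact neg_eq_of_add_eq_zero_right h⟩)
  rep_projEven a j := by
    induction a using Quotient.inductionOn' with | _ a
    exact congrArg (Submodule.Quotient.mk (p := (g.oddBoundary _).submoduleOf _))
      (Subtype.ext (c.rep_projEven a j.castSucc))
  sq_projOdd v j := by
    induction v using Quotient.inductionOn' with | _ v
    exact congrArg (Submodule.Quotient.mk (p := (g.evenBoundary _).toSubmodule))
      (Subtype.ext (c.sq_projOdd v j.castSucc))
  projOdd_rep a j := by
    induction a using Quotient.inductionOn' with | _ a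
    exact congrArg (Submodule.Quotient.mk (p := (g.oddBoundary _).submoduleOf _))
      (Subtype.ext (c.projOdd_rep a j.castSucc))
  projEven_sq v j := by
    induction v using Quotient.inductionOn' with | _ v
    exact congrArg (Submodule.Quotient.mk (p := (g.evenBoundary _).toSubmodule))
      (Subtype.ext (c.projEven_sq v j.castSucc))
  homotopyEven a := by
    induction a using Quotient.inductionOn' with | _ a
    have hi (i : Fin k) := (Fin.castSucc_lt_last i).ne
    change (g.evenBoundary (x (Fin.last k))).toSubmodule.mkQ a =
      (g.evenBoundary (x (Fin.last k))).toSubmodule.mkQ ⟨c.projEven a, c.rep_projEven _ _⟩ +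
      ∑ i : Fin k, (g.evenBoundary (x (Fin.last k))).toSubmodule.mkQ
        ((⟨g.sq (x i.castSucc) (c.homEven i.castSucc a),
          sq_mem_evenCentralizer (hx _ _) (c.homEven_mem (hi i) a.2)⟩ :
            g.evenCentralizer (x (Fin.last k))) +
          ⟨c.homOdd i.castSucc (g.rep a (x i.castSucc)),
            c.homOdd_mem (hi i) (rep_mem_oddCentralizer (hx _ _) a.2)⟩)
    rw [← map_sum, ← map_add]
    -- The last summand of the homotopy formula disappears in the quotient: sD vanishes on the
    -- centraliser, and Ds is a boundary.
    refine (Submodule.Quotient.eq (g.evenBoundary (x (Fin.last k))).toSubmodule).2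
      ⟨c.homEven (Fin.last k) a, ?_⟩
    have h := c.homotopyEven a
    rw [Fin.sum_univ_castSucc, (g.mem_evenCentralizer _).mp a.2, map_zero, add_zero,
      ← add_assoc] at h
    refine (sub_eq_of_eq_add' h).symm.trans (congrArg (fun z => (a : g.even) - z) ?_)
    simp only [AddMemClass.coe_add, AddSubmonoidClass.coe_finsetSum]
  homotopyOdd v := by
    induction v using Quotient.inductionOn' with | _ v
    have hi (i : Fin k) := (Fin.castSucc_lt_last i).ne
    change ((g.oddBoundary (x (Fin.last k))).submoduleOf _).mkQ v =
      ((g.oddBoundary (x (Fin.last k))).submoduleOf _).mkQ ⟨c.projOdd v, c.sq_projOdd _ _⟩ +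
      ∑ i : Fin k, ((g.oddBoundary (x (Fin.last k))).submoduleOf _).mkQ
        ((⟨g.rep (c.homOdd i.castSucc v) (x i.castSucc),
          rep_mem_oddCentralizer (hx _ _) (c.homOdd_mem (hi i) v.2)⟩ :
            g.oddCentralizer (x (Fin.last k))) +
          ⟨c.homEven i.castSucc (g.sq (x i.castSucc) v),
            c.homEven_mem (hi i) (sq_mem_evenCentralizer (hx _ _) v.2)⟩)
    rw [← map_sum, ← map_add]
    refine (Submodule.Quotient.eq ((g.oddBoundary (x (Fin.last k))).submoduleOf _)).2
      ⟨c.homOdd (Fin.last k) v, ?_⟩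
    have h := c.homotopyOdd v
    rw [Fin.sum_univ_castSucc, (g.mem_oddCentralizer _).mp v.2, map_zero, add_zero,
      ← add_assoc] at h
    refine (sub_eq_of_eq_add' h).symm.trans (congrArg (fun z => (v : g.odd) - z) ?_)
    simp only [AddMemClass.coe_add, AddSubmonoidClass.coe_finsetSum]
  anticommEven i j hij a := by
    induction a using Quotient.inductionOn' with | _ a
    exact congrArg (Submodule.Quotient.mk (p := (g.evenBoundary _).toSubmodule))
      (Subtype.ext (c.anticommEven i.castSucc j.castSucc (by simpa using hij) a))
  anticommOdd i j hij v := by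
    induction v using Quotient.inductionOn' with | _ v
    exact congrArg (Submodule.Quotient.mk (p := (g.oddBoundary _).submoduleOf _))
      (Subtype.ext (c.anticommOdd i.castSucc j.castSucc (by simpa using hij) v))
  projEven_cartan := by
    rintro _ ⟨a, ha, rfl⟩
    exact ⟨⟨c.projEven a, c.rep_projEven _ _⟩, c.projEven_cartan a ha, rfl⟩

/-! ### The iterated algebra as a quotient of the common centraliser -/

section

variable {k : ℕ} {x : Fin k → g.odd}

/-- Apply π to the homotopy formula: πDᵢ = 0 kills one half of the sum, and Dᵢa = 0 the other.
Idempotence of π is needed only on the common centraliser. -/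
theorem projEven_projEven (c : Contraction g x) {a : g.even} (ha : ∀ i, g.rep a (x i) = 0) :
    c.projEven (c.projEven a) = c.projEven a := by
  have h := congrArg c.projEven (c.homotopyEven a)
  simp only [ha, map_zero, add_zero, map_add, map_sum, c.projEven_sq,
    Finset.sum_const_zero] at h
  exact h.symm

theorem projOdd_projOdd (c : Contraction g x) {v : g.odd} (hv : ∀ i, g.sq (x i) v = 0) :
    c.projOdd (c.projOdd v) = c.projOdd v := by
  have h := congrArg c.projOdd (c.homotopyOdd v)
  simp only [hv, map_zero, add_zero, map_add, map_sum, c.projOdd_rep,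
    Finset.sum_const_zero] at h
  exact h.symm

end

end Contraction

variable {g : CartanPair.{u}}

/-! ### Compatibility of the iterated class map with the algebra structure. -/

section Iterate

/-- The operations of 𝔤_y are computed on representatives, so in this and the following inductions
each stage holds definitionally. -/
theorem iterEven_add : ∀ (k : ℕ) (g : CartanPair.{u}) (x : Fin k → g.odd)
    (hx : ∀ i j, g.sq (x i) (x j) = 0) (a b : g.even) (ha : ∀ i, g.rep a (x i) = 0)
    (hb : ∀ i, g.rep b (x i) = 0) (hab : ∀ i, g.rep (a + b) (x i) = 0),
    iterEven k g x hx (a + b) hab = iterEven k g x hx a ha + iterEven k g x hx b hb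
  | 0, _, _, _, _, _, _, _, _ => rfl
  | k + 1, _, x, hx, a, b, ha, hb, hab => iterEven_add k _ (descend x hx) (descend_sq x hx)
      _ _ (descend_rep x hx a ha) (descend_rep x hx b hb) (descend_rep x hx _ hab)

theorem iterEven_smul : ∀ (k : ℕ) (g : CartanPair.{u}) (x : Fin k → g.odd)
    (hx : ∀ i j, g.sq (x i) (x j) = 0) (r : ℂ) (a : g.even) (ha : ∀ i, g.rep a (x i) = 0)
    (hra : ∀ i, g.rep (r • a) (x i) = 0),
    iterEven k g x hx (r • a) hra = r • iterEven k g x hx a ha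
  | 0, _, _, _, _, _, _, _ => rfl
  | k + 1, _, x, hx, r, a, ha, hra => iterEven_smul k _ (descend x hx) (descend_sq x hx)
      r _ (descend_rep x hx a ha) (descend_rep x hx _ hra)

theorem iterOdd_add : ∀ (k : ℕ) (g : CartanPair.{u}) (x : Fin k → g.odd)
    (hx : ∀ i j, g.sq (x i) (x j) = 0) (v w : g.odd) (hv : ∀ i, g.sq (x i) v = 0)
    (hw : ∀ i, g.sq (x i) w = 0) (hvw : ∀ i, g.sq (x i) (v + w) = 0),
    iterOdd k g x hx (v + w) hvw = iterOdd k g x hx v hv + iterOdd k g x hx w hw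
  | 0, _, _, _, _, _, _, _, _ => rfl
  | k + 1, _, x, hx, v, w, hv, hw, hvw => iterOdd_add k _ (descend x hx) (descend_sq x hx)
      _ _ (descend_sq_left x hx v hv) (descend_sq_left x hx w hw) (descend_sq_left x hx _ hvw)

theorem iterOdd_smul : ∀ (k : ℕ) (g : CartanPair.{u}) (x : Fin k → g.odd)
    (hx : ∀ i j, g.sq (x i) (x j) = 0) (r : ℂ) (v : g.odd) (hv : ∀ i, g.sq (x i) v = 0)
    (hrv : ∀ i, g.sq (x i) (r • v) = 0),
    iterOdd k g x hx (r • v) hrv = r • iterOdd k g x hx v hv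
  | 0, _, _, _, _, _, _, _ => rfl
  | k + 1, _, x, hx, r, v, hv, hrv => iterOdd_smul k _ (descend x hx) (descend_sq x hx)
      r _ (descend_sq_left x hx v hv) (descend_sq_left x hx _ hrv)

theorem iterEven_lie : ∀ (k : ℕ) (g : CartanPair.{u}) (x : Fin k → g.odd)
    (hx : ∀ i j, g.sq (x i) (x j) = 0) (a b : g.even) (ha : ∀ i, g.rep a (x i) = 0)
    (hb : ∀ i, g.rep b (x i) = 0) (hab : ∀ i, g.rep ⁅a, b⁆ (x i) = 0),
    iterEven k g x hx ⁅a, b⁆ hab = ⁅iterEven k g x hx a ha, iterEven k g x hx b hb⁆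
  | 0, _, _, _, _, _, _, _, _ => rfl
  | k + 1, _, x, hx, a, b, ha, hb, hab => iterEven_lie k _ (descend x hx) (descend_sq x hx)
      _ _ (descend_rep x hx a ha) (descend_rep x hx b hb) (descend_rep x hx _ hab)

theorem iterOdd_rep : ∀ (k : ℕ) (g : CartanPair.{u}) (x : Fin k → g.odd)
    (hx : ∀ i j, g.sq (x i) (x j) = 0) (a : g.even) (v : g.odd) (ha : ∀ i, g.rep a (x i) = 0)
    (hv : ∀ i, g.sq (x i) v = 0) (hav : ∀ i, g.sq (x i) (g.rep a v) = 0),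
    iterOdd k g x hx (g.rep a v) hav =
      (iter k g x hx).rep (iterEven k g x hx a ha) (iterOdd k g x hx v hv)
  | 0, _, _, _, _, _, _, _, _ => rfl
  | k + 1, _, x, hx, a, v, ha, hv, hav => iterOdd_rep k _ (descend x hx) (descend_sq x hx)
      _ _ (descend_rep x hx a ha) (descend_sq_left x hx v hv) (descend_sq_left x hx _ hav)

theorem iterEven_sq : ∀ (k : ℕ) (g : CartanPair.{u}) (x : Fin k → g.odd)
    (hx : ∀ i j, g.sq (x i) (x j) = 0) (v w : g.odd) (hv : ∀ i, g.sq (x i) v = 0)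
    (hw : ∀ i, g.sq (x i) w = 0) (hvw : ∀ i, g.rep (g.sq v w) (x i) = 0),
    iterEven k g x hx (g.sq v w) hvw =
      (iter k g x hx).sq (iterOdd k g x hx v hv) (iterOdd k g x hx w hw)
  | 0, _, _, _, _, _, _, _, _ => rfl
  | k + 1, _, x, hx, v, w, hv, hw, hvw => iterEven_sq k _ (descend x hx) (descend_sq x hx)
      _ _ (descend_sq_left x hx v hv) (descend_sq_left x hx w hw) (descend_rep x hx _ hvw)

theorem iterEven_mem_cartan : ∀ (k : ℕ) (g : CartanPair.{u}) (x : Fin k → g.odd)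
    (hx : ∀ i j, g.sq (x i) (x j) = 0) (a : g.even) (ha : ∀ i, g.rep a (x i) = 0),
    a ∈ g.cartan → iterEven k g x hx a ha ∈ (iter k g x hx).cartan
  | 0, _, _, _, _, _, h => h
  | k + 1, _, x, hx, a, ha, h => iterEven_mem_cartan k _ (descend x hx) (descend_sq x hx)
      _ (descend_rep x hx a ha) ⟨⟨a, ha _⟩, h, rfl⟩

end Iterate

theorem iter_congr_even {k : ℕ} {x : Fin k → g.odd} {hx : ∀ i j, g.sq (x i) (x j) = 0}
    {a b : g.even} (h : a = b) (ha : ∀ i, g.rep a (x i) = 0) (hb : ∀ i, g.rep b (x i) = 0) :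
    iterEven k g x hx a ha = iterEven k g x hx b hb := by
  subst h
  rfl

/-! ### Kernel and image of the iterated class map. -/

namespace Contraction

/-- By induction, the class vanishes iff the descended projection kills the class of a in
𝔤_{x_{k+1}}, that is, iff πa is a boundary for x_{k+1}. Then πa = ππa = 0, since π kills boundaries.
-/
theorem iterEven_eq_zero_iff : ∀ {k : ℕ} {g : CartanPair.{u}} {x : Fin k → g.odd}
    (c : Contraction g x) (hx : ∀ i j, g.sq (x i) (x j) = 0) (a : g.even)
    (ha : ∀ i, g.rep a (x i) = 0), iterEven k g x hx a ha = 0 ↔ c.projEven a = 0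
  | 0, g, x, c, hx, a, ha => by
    have h : a = c.projEven a := by simpa using c.homotopyEven a
    rw [← h]
    rfl
  | k + 1, g, x, c, hx, a, ha => by
    refine ((c.descend hx).iterEven_eq_zero_iff (descend_sq x hx) _ (descend_rep x hx a ha)).trans
      ?_
    change (g.evenBoundary (x (Fin.last k))).toSubmodule.mkQ
      ⟨c.projEven a, c.rep_projEven _ _⟩ = 0 ↔ _
    rw [Submodule.mkQ_apply, Submodule.Quotient.mk_eq_zero]
    constructor
    · rintro ⟨v, hv⟩
      rw [← c.projEven_projEven ha, ← show g.sq _ v = c.projEven a from hv, c.projEven_sq]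
    · intro h
      exact ⟨0, by rw [map_zero]; exact h.symm⟩

theorem iterOdd_eq_zero_iff : ∀ {k : ℕ} {g : CartanPair.{u}} {x : Fin k → g.odd}
    (c : Contraction g x) (hx : ∀ i j, g.sq (x i) (x j) = 0) (v : g.odd)
    (hv : ∀ i, g.sq (x i) v = 0), iterOdd k g x hx v hv = 0 ↔ c.projOdd v = 0
  | 0, g, x, c, hx, v, hv => by
    have h : v = c.projOdd v := by simpa using c.homotopyOdd v
    rw [← h]
    rfl
  | k + 1, g, x, c, hx, v, hv => by
    refine ((c.descend hx).iterOdd_eq_zero_iff (descend_sq x hx) _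
      (descend_sq_left x hx v hv)).trans ?_
    change ((g.oddBoundary (x (Fin.last k))).submoduleOf _).mkQ
      ⟨c.projOdd v, c.sq_projOdd _ _⟩ = 0 ↔ _
    rw [Submodule.mkQ_apply, Submodule.Quotient.mk_eq_zero]
    constructor
    · rintro ⟨a, ha⟩
      rw [← c.projOdd_projOdd hv, ← show g.rep a _ = c.projOdd v from ha, c.projOdd_rep]
    · intro h
      exact ⟨0, by rw [map_zero]; exact h.symm⟩

/-- The difference a - πa lies in the common centraliser and is killed by π, so its class is zero.
-/
theorem iterEven_projEven {k : ℕ} {x : Fin k → g.odd} (c : Contraction g x)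
    (hx : ∀ i j, g.sq (x i) (x j) = 0) (a : g.even) (ha : ∀ i, g.rep a (x i) = 0) :
    iterEven k g x hx (c.projEven a) (c.rep_projEven a) = iterEven k g x hx a ha := by
  have h0 : ∀ i, g.rep (a - c.projEven a) (x i) = 0 := fun i => by
    rw [map_sub, LinearMap.sub_apply, ha, c.rep_projEven, sub_zero]
  have h := (c.iterEven_eq_zero_iff hx _ h0).2 (by rw [map_sub, c.projEven_projEven ha, sub_self])
  have h1 := iterEven_add k g x hx _ _ h0 (c.rep_projEven a) (by simpa using ha)
  rw [h, zero_add] at h1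
  rw [← h1]
  exact iter_congr_even (by simp) _ _

theorem iterOdd_projOdd {k : ℕ} {x : Fin k → g.odd} (c : Contraction g x)
    (hx : ∀ i j, g.sq (x i) (x j) = 0) (v : g.odd) (hv : ∀ i, g.sq (x i) v = 0) :
    iterOdd k g x hx (c.projOdd v) (c.sq_projOdd v) = iterOdd k g x hx v hv := by
  have h0 : ∀ i, g.sq (x i) (v - c.projOdd v) = 0 := fun i => by
    rw [map_sub, hv, c.sq_projOdd, sub_zero]
  have h := (c.iterOdd_eq_zero_iff hx _ h0).2 (by rw [map_sub, c.projOdd_projOdd hv, sub_self])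
  have h1 := iterOdd_add k g x hx _ _ h0 (c.sq_projOdd v) (by simpa using hv)
  rw [h, zero_add] at h1
  rw [← h1]
  congr 1
  simp

/-- A class in 𝔤_{x_{k+1}} commuting with the remaining classes need not obviously lift to an
element commuting with all xᵢ. Replacing it by its projection cures this: the projection lifts to
πa. -/
theorem exists_iterEven : ∀ {k : ℕ} {g : CartanPair.{u}} {x : Fin k → g.odd}
    (_ : Contraction g x) (hx : ∀ i j, g.sq (x i) (x j) = 0) (z : (iter k g x hx).even),
    ∃ a ha, iterEven k g x hx a ha = z
  | 0, _, _, _, _, z => ⟨z, fun i => i.elim0, rfl⟩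
  | k + 1, g, x, c, hx, z => by
    obtain ⟨a, ha, rfl⟩ := exists_iterEven (c.descend hx) (descend_sq x hx) z
    rw [← (c.descend hx).iterEven_projEven (descend_sq x hx) a ha]
    induction a using Quotient.inductionOn' with | _ a
    exact ⟨c.projEven a, c.rep_projEven _, rfl⟩

theorem exists_iterOdd : ∀ {k : ℕ} {g : CartanPair.{u}} {x : Fin k → g.odd}
    (_ : Contraction g x) (hx : ∀ i j, g.sq (x i) (x j) = 0) (z : (iter k g x hx).odd),
    ∃ v hv, iterOdd k g x hx v hv = z
  | 0, _, _, _, _, z => ⟨z, fun i => i.elim0, rfl⟩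
  | k + 1, g, x, c, hx, z => by
    obtain ⟨v, hv, rfl⟩ := exists_iterOdd (c.descend hx) (descend_sq x hx) z
    rw [← (c.descend hx).iterOdd_projOdd (descend_sq x hx) v hv]
    induction v using Quotient.inductionOn' with | _ v
    exact ⟨c.projOdd v, c.sq_projOdd _, rfl⟩

/-- The same lifting works inside 𝔥 because π preserves 𝔥. -/
theorem exists_iterEven_of_mem_cartan : ∀ {k : ℕ} {g : CartanPair.{u}} {x : Fin k → g.odd}
    (_ : Contraction g x) (hx : ∀ i j, g.sq (x i) (x j) = 0) (z : (iter k g x hx).even),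
    z ∈ (iter k g x hx).cartan → ∃ a ∈ g.cartan, ∃ ha, iterEven k g x hx a ha = z
  | 0, _, _, _, _, z, hz => ⟨z, hz, fun i => i.elim0, rfl⟩
  | k + 1, g, x, c, hx, z, hz => by
    obtain ⟨_, ⟨a, ha, rfl⟩, ha', rfl⟩ :=
      exists_iterEven_of_mem_cartan (c.descend hx) (descend_sq x hx) z hz
    refine ⟨c.projEven a, c.projEven_cartan _ ha, c.rep_projEven _, ?_⟩
    exact (c.descend hx).iterEven_projEven (descend_sq x hx) _ ha'

/-! ### The homology of D = ∑ Dᵢ. -/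

section Sum

variable {k : ℕ} {x : Fin k → g.odd} (c : Contraction g x) (hx : ∀ i j, g.sq (x i) (x j) = 0)

/-- In Ds + sD the terms with i ≠ j cancel by anticommutation, leaving the diagonal sum of the
homotopy formula. -/
theorem homotopyEven_sum (a : g.even) : a = c.projEven a +
    (g.sq (∑ i, x i) (∑ i, c.homEven i a) + ∑ i, c.homOdd i (g.rep a (∑ i, x i))) := by
  classical
  conv_lhs => rw [c.homotopyEven a]
  simp only [map_sum, LinearMap.sum_apply]
  rw [← Finset.sum_add_distrib]
  congr 1
  refine Finset.sum_congr rfl fun i _ => ?_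
  rw [← Finset.sum_add_distrib, Finset.sum_eq_single i _ (by simp)]
  exact fun j _ hj => c.anticommEven i j hj.symm a

theorem homotopyOdd_sum (v : g.odd) : v = c.projOdd v +
    (g.rep (∑ i, c.homOdd i v) (∑ i, x i) + ∑ i, c.homEven i (g.sq (∑ i, x i) v)) := by
  classical
  conv_lhs => rw [c.homotopyOdd v]
  simp only [map_sum, LinearMap.sum_apply]
  rw [Finset.sum_comm, ← Finset.sum_add_distrib]
  congr 1
  refine Finset.sum_congr rfl fun i _ => ?_
  rw [← Finset.sum_add_distrib, Finset.sum_eq_single i _ (by simp)]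
  exact fun j _ hj => c.anticommOdd i j hj.symm v

/-- π kills boundaries; conversely, if Da = 0 and πa = 0, the homotopy formula reads a = Dsa. -/
theorem evenClass_sum_eq_zero_iff (a : g.even) (ha : g.rep a (∑ i, x i) = 0) :
    g.evenClass (∑ i, x i) (sq_sum x hx) a ha = 0 ↔ c.projEven a = 0 := by
  change (g.evenBoundary (∑ i, x i)).toSubmodule.mkQ ⟨a, ha⟩ = 0 ↔ _
  rw [Submodule.mkQ_apply, Submodule.Quotient.mk_eq_zero]
  constructor
  · rintro ⟨v, hv⟩
    rw [← show g.sq _ v = a from hv, map_sum, LinearMap.sum_apply, map_sum]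
    exact Finset.sum_eq_zero fun i _ => c.projEven_sq v i
  · intro h
    refine ⟨∑ i, c.homEven i a, ?_⟩
    have h1 := c.homotopyEven_sum a
    rw [h, ha] at h1
    simpa using h1.symm

theorem oddClass_sum_eq_zero_iff (v : g.odd) (hv : g.sq (∑ i, x i) v = 0) :
    g.oddClass (∑ i, x i) (sq_sum x hx) v hv = 0 ↔ c.projOdd v = 0 := by
  change ((g.oddBoundary (∑ i, x i)).submoduleOf _).mkQ ⟨v, hv⟩ = 0 ↔ _
  rw [Submodule.mkQ_apply, Submodule.Quotient.mk_eq_zero]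
  constructor
  · rintro ⟨a, ha⟩
    rw [← show g.rep a _ = v from ha, map_sum, map_sum]
    exact Finset.sum_eq_zero fun i _ => c.projOdd_rep a i
  · intro h
    refine ⟨∑ i, c.homOdd i v, ?_⟩
    have h1 := c.homotopyOdd_sum v
    rw [h, hv] at h1
    simp only [zero_add, map_zero, Finset.sum_const_zero, add_zero] at h1
    exact h1.symm

theorem evenClass_sum_projEven (a : g.even) (ha : g.rep a (∑ i, x i) = 0) :
    g.evenClass (∑ i, x i) (sq_sum x hx) (c.projEven a) (rep_sum x (c.rep_projEven a)) =
      g.evenClass (∑ i, x i) (sq_sum x hx) a ha := by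
  refine ((Submodule.Quotient.eq (g.evenBoundary (∑ i, x i)).toSubmodule).2
    ⟨∑ i, c.homEven i a, ?_⟩).symm
  have h1 := c.homotopyEven_sum a
  rw [ha] at h1
  exact eq_sub_of_add_eq' (by
    simpa only [map_zero, Finset.sum_const_zero, add_zero] using h1.symm)

theorem oddClass_sum_projOdd (v : g.odd) (hv : g.sq (∑ i, x i) v = 0) :
    g.oddClass (∑ i, x i) (sq_sum x hx) (c.projOdd v) (sq_sum_left x (c.sq_projOdd v)) =
      g.oddClass (∑ i, x i) (sq_sum x hx) v hv := by
  refine ((Submodule.Quotient.eq ((g.oddBoundary (∑ i, x i)).submoduleOf _)).2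
    ⟨∑ i, c.homOdd i v, ?_⟩).symm
  have h1 := c.homotopyOdd_sum v
  rw [hv] at h1
  exact eq_sub_of_add_eq' (by
    simp only [map_zero, Finset.sum_const_zero, add_zero] at h1
    exact h1.symm)

end Sum

end Contraction

/-! ### The isomorphism through the common centraliser. -/

section CommonCentralizer

variable {k : ℕ} (x : Fin k → g.odd) (hx : ∀ i j, g.sq (x i) (x j) = 0)

/-- The even part of `⋂ᵢ 𝔤^{xᵢ}`. -/
def evenCommon : Submodule ℂ g.even where
  carrier := {a | ∀ i, g.rep a (x i) = 0}
  zero_mem' := by simp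
  add_mem' ha hb i := by rw [map_add, LinearMap.add_apply, ha i, hb i, add_zero]
  smul_mem' r a ha i := by rw [map_smul, LinearMap.smul_apply, ha i, smul_zero]

/-- The odd part of `⋂ᵢ 𝔤^{xᵢ}`. -/
def oddCommon : Submodule ℂ g.odd where
  carrier := {v | ∀ i, g.sq (x i) v = 0}
  zero_mem' := by simp
  add_mem' ha hb i := by rw [map_add, ha i, hb i, add_zero]
  smul_mem' r a ha i := by rw [map_smul, ha i, smul_zero]

/-- The class map `⋂ᵢ 𝔤^{xᵢ} → 𝔤_{x₁ + ⋯ + x_k}` on even elements. -/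
def evenToSum : evenCommon x →ₗ[ℂ] (g.ds (∑ i, x i) (sq_sum x hx)).even where
  toFun a := g.evenClass _ (sq_sum x hx) a (rep_sum x a.2)
  map_add' _ _ := rfl
  map_smul' _ _ := rfl

/-- The class map `⋂ᵢ 𝔤^{xᵢ} → 𝔤_{x₁ + ⋯ + x_k}` on odd elements. -/
def oddToSum : oddCommon x →ₗ[ℂ] (g.ds (∑ i, x i) (sq_sum x hx)).odd where
  toFun v := g.oddClass _ (sq_sum x hx) v (sq_sum_left x v.2)
  map_add' _ _ := rfl
  map_smul' _ _ := rfl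

/-- The class map from `⋂ᵢ 𝔤^{xᵢ}` to the iterated algebra on even elements. -/
def evenToIter : evenCommon x →ₗ[ℂ] (iter k g x hx).even where
  toFun a := iterEven k g x hx a a.2
  map_add' a b := iterEven_add k g x hx a b a.2 b.2 _
  map_smul' r a := iterEven_smul k g x hx r a a.2 _

/-- The class map from `⋂ᵢ 𝔤^{xᵢ}` to the iterated algebra on odd elements. -/
def oddToIter : oddCommon x →ₗ[ℂ] (iter k g x hx).odd where
  toFun v := iterOdd k g x hx v v.2
  map_add' v w := iterOdd_add k g x hx v w v.2 w.2 _
  map_smul' r v := iterOdd_smul k g x hx r v v.2 _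

variable {x}

theorem evenToSum_surjective (c : Contraction g x) : Function.Surjective (evenToSum x hx) := by
  intro z
  induction z using Quotient.inductionOn' with | _ a
  exact ⟨⟨c.projEven a, c.rep_projEven _⟩, c.evenClass_sum_projEven hx a a.2⟩

theorem oddToSum_surjective (c : Contraction g x) : Function.Surjective (oddToSum x hx) := by
  intro z
  induction z using Quotient.inductionOn' with | _ v
  exact ⟨⟨c.projOdd v, c.sq_projOdd _⟩, c.oddClass_sum_projOdd hx v v.2⟩

theorem evenToIter_surjective (c : Contraction g x) : Function.Surjective (evenToIter x hx) := by
  intro z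
  obtain ⟨a, ha, h⟩ := c.exists_iterEven hx z
  exact ⟨⟨a, ha⟩, h⟩

theorem oddToIter_surjective (c : Contraction g x) : Function.Surjective (oddToIter x hx) := by
  intro z
  obtain ⟨a, ha, h⟩ := c.exists_iterOdd hx z
  exact ⟨⟨a, ha⟩, h⟩

/-- The even part of the isomorphism between `𝔤_{x₁ + ⋯ + x_k}` and the iterated algebra. -/
def Contraction.isoEven (c : Contraction g x) :
    (g.ds (∑ i, x i) (sq_sum x hx)).even ≃ₗ[ℂ] (iter k g x hx).even :=
  equivOfKerEq (evenToSum x hx) (evenToIter x hx) (evenToSum_surjective hx c)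
    (evenToIter_surjective hx c) fun a =>
      (c.evenClass_sum_eq_zero_iff hx a (rep_sum x a.2)).trans (c.iterEven_eq_zero_iff hx a a.2).symm

/-- The odd part of the isomorphism between `𝔤_{x₁ + ⋯ + x_k}` and the iterated algebra. -/
def Contraction.isoOdd (c : Contraction g x) :
    (g.ds (∑ i, x i) (sq_sum x hx)).odd ≃ₗ[ℂ] (iter k g x hx).odd :=
  equivOfKerEq (oddToSum x hx) (oddToIter x hx) (oddToSum_surjective hx c)
    (oddToIter_surjective hx c) fun v =>
      (c.oddClass_sum_eq_zero_iff hx v (sq_sum_left x v.2)).trans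
        (c.iterOdd_eq_zero_iff hx v v.2).symm

theorem Contraction.isoEven_apply (c : Contraction g x) (a : g.even)
    (ha : ∀ i, g.rep a (x i) = 0) :
    c.isoEven hx (g.evenClass _ (sq_sum x hx) a (rep_sum x ha)) = iterEven k g x hx a ha :=
  equivOfKerEq_apply (evenToSum x hx) (evenToIter x hx) (evenToSum_surjective hx c)
    (evenToIter_surjective hx c) (fun a =>
      (c.evenClass_sum_eq_zero_iff hx a (rep_sum x a.2)).trans
        (c.iterEven_eq_zero_iff hx a a.2).symm) ⟨a, ha⟩

theorem Contraction.isoOdd_apply (c : Contraction g x) (v : g.odd)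
    (hv : ∀ i, g.sq (x i) v = 0) :
    c.isoOdd hx (g.oddClass _ (sq_sum x hx) v (sq_sum_left x hv)) = iterOdd k g x hx v hv :=
  equivOfKerEq_apply (oddToSum x hx) (oddToIter x hx) (oddToSum_surjective hx c)
    (oddToIter_surjective hx c) (fun v =>
      (c.oddClass_sum_eq_zero_iff hx v (sq_sum_left x v.2)).trans
        (c.iterOdd_eq_zero_iff hx v v.2).symm) ⟨v, hv⟩

/-- The isomorphism between `𝔤_{x₁ + ⋯ + x_k}` and the iterated algebra given by a contraction. -/
def Contraction.iso (c : Contraction g x) :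
    (g.ds (∑ i, x i) (sq_sum x hx)).Iso (iter k g x hx) where
  even := c.isoEven hx
  odd := c.isoOdd hx
  map_lie a b := by
    obtain ⟨⟨a, ha⟩, rfl⟩ := evenToSum_surjective hx c a
    obtain ⟨⟨b, hb⟩, rfl⟩ := evenToSum_surjective hx c b
    have hab : ∀ i, g.rep ⁅a, b⁆ (x i) = 0 := fun i => by
      rw [g.rep_lie, ha i, hb i]
      simp
    refine (c.isoEven_apply hx _ hab).trans ((iterEven_lie k g x hx a b ha hb hab).trans ?_)
    exact congrArg₂ (fun a b => ⁅a, b⁆) (c.isoEven_apply hx _ ha).symm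
      (c.isoEven_apply hx _ hb).symm
  map_rep a v := by
    obtain ⟨⟨a, ha⟩, rfl⟩ := evenToSum_surjective hx c a
    obtain ⟨⟨v, hv⟩, rfl⟩ := oddToSum_surjective hx c v
    have hav : ∀ i, g.sq (x i) (g.rep a v) = 0 := fun i => by
      have h := g.lie_sq a (x i) v
      rw [ha i, hv i] at h
      simpa using h.symm
    refine (c.isoOdd_apply hx _ hav).trans ((iterOdd_rep k g x hx a v ha hv hav).trans ?_)
    exact congrArg₂ (fun a v => (iter k g x hx).rep a v) (c.isoEven_apply hx _ ha).symm
      (c.isoOdd_apply hx _ hv).symm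
  map_sq v w := by
    obtain ⟨⟨v, hv⟩, rfl⟩ := oddToSum_surjective hx c v
    obtain ⟨⟨w, hw⟩, rfl⟩ := oddToSum_surjective hx c w
    have hvw : ∀ i, g.rep (g.sq v w) (x i) = 0 := fun i => by
      rw [g.jacobi', g.sq_comm w, hv i, hw i]
      simp
    refine (c.isoEven_apply hx _ hvw).trans ((iterEven_sq k g x hx v w hv hw hvw).trans ?_)
    exact congrArg₂ (fun v w => (iter k g x hx).sq v w) (c.isoOdd_apply hx _ hv).symm
      (c.isoOdd_apply hx _ hw).symm
  map_cartan := by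
    apply le_antisymm
    · rintro _ ⟨_, ⟨a, ha, rfl⟩, rfl⟩
      have h : c.isoEven hx (g.evenClass _ (sq_sum x hx) a a.2) ∈ (iter k g x hx).cartan := by
        -- The element a ∈ 𝔥 is only known to commute with the sum of the xᵢ. Its projection has the
        -- same class, lies in 𝔥 and commutes with each xᵢ.
        rw [← c.evenClass_sum_projEven hx a a.2, c.isoEven_apply _ _ (c.rep_projEven _)]
        exact iterEven_mem_cartan _ _ _ _ _ _ (c.projEven_cartan _ ha)
      exact h
    · intro z hz
      obtain ⟨a, ha, ha', rfl⟩ := c.exists_iterEven_of_mem_cartan hx z hz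
      exact ⟨_, ⟨⟨a, rep_sum x ha'⟩, ha, rfl⟩, c.isoEven_apply hx a ha'⟩

end CommonCentralizer

/-! ### Comparison of the supercharacter maps. -/

section Supercharacters

theorem pullback_comp {t t' t'' : Type*} [AddCommGroup t] [Module ℂ t] [AddCommGroup t']
    [Module ℂ t'] [AddCommGroup t''] [Module ℂ t''] (π : t' →ₗ[ℂ] t) (ρ : t'' →ₗ[ℂ] t')
    (f : AddMonoidAlgebra ℤ (Module.Dual ℂ t)) :
    pullback ρ (pullback π f) = pullback (π ∘ₗ ρ) f := by
  apply AddMonoidAlgebra.coeff_injective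
  change Finsupp.mapDomain _ (Finsupp.mapDomain _ f.coeff) = Finsupp.mapDomain _ f.coeff
  rw [← Finsupp.mapDomain_comp]
  rfl

/-- This characterises ds_x: f and ds_x f have the same restriction to 𝔥 ∩ 𝔤^x, and that space maps
onto 𝔥_x. -/
theorem pullback_dsHom (x : g.odd) (hx : g.sq x x = 0) (f : J g) :
    pullback (toCartanDS x hx) (dsHom x hx f : AddMonoidAlgebra ℤ _) =
      pullback (toCartan x) (f : AddMonoidAlgebra ℤ _) := by
  obtain ⟨m, rfl⟩ := (schHom g).rangeRestrict_surjective f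
  have := AddMonoidHom.liftOfRightInverse_comp_apply (schHom g).rangeRestrict _
    (Function.rightInverse_surjInv (schHom g).rangeRestrict_surjective)
    ⟨dsFree x hx, ker_le x hx⟩ m
  exact (congrArg (fun z : J (g.ds x hx) => pullback (toCartanDS x hx) z.1) this).trans
    (pullback_schHom x hx m).symm

theorem pullback_dsHom_of_eq {L : Type*} [AddCommGroup L] [Module ℂ L] (x : g.odd)
    (hx : g.sq x x = 0) (φ : L →ₗ[ℂ] g.cartan) (hφ : ∀ l, g.rep (φ l) x = 0)
    (ψ : L →ₗ[ℂ] (g.ds x hx).cartan)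
    (hψ : ∀ l, (ψ l : (g.ds x hx).even) = g.evenClass x hx (φ l) (hφ l)) (f : J g) :
    pullback ψ (dsHom x hx f : AddMonoidAlgebra ℤ _) =
      pullback φ (f : AddMonoidAlgebra ℤ _) := by
  let χ : L →ₗ[ℂ] g.cartanCentralizer x :=
    { toFun l := ⟨⟨φ l, hφ l⟩, (φ l).2⟩
      map_add' a b := by ext; simp
      map_smul' r a := by ext; simp }
  have h1 : ψ = toCartanDS x hx ∘ₗ χ := LinearMap.ext fun l => Subtype.ext (hψ l)
  have h2 : φ = toCartan x ∘ₗ χ := rfl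
  rw [h1, ← pullback_comp, pullback_dsHom, pullback_comp, ← h2]

/-- The auxiliary space L stays fixed while the algebra changes along the induction, so no
description of the intermediate Cartan subspaces is needed. -/
theorem pullback_dsComp {L : Type*} [AddCommGroup L] [Module ℂ L] : ∀ (k : ℕ)
    (g : CartanPair.{u}) (x : Fin k → g.odd) (hx : ∀ i j, g.sq (x i) (x j) = 0)
    (φ : L →ₗ[ℂ] g.cartan) (hφ : ∀ l i, g.rep (φ l) (x i) = 0)
    (ψ : L →ₗ[ℂ] (iter k g x hx).cartan)
    (_ : ∀ l, (ψ l : (iter k g x hx).even) = iterEven k g x hx (φ l) (hφ l)) (f : J g),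
    pullback ψ (dsComp k g x hx f : AddMonoidAlgebra ℤ _) =
      pullback φ (f : AddMonoidAlgebra ℤ _)
  | 0, g, x, hx, φ, hφ, ψ, hψ, f => by
    have h : ψ = φ := LinearMap.ext fun l => Subtype.ext (hψ l)
    rw [h]
    rfl
  | k + 1, g, x, hx, φ, hφ, ψ, hψ, f => by
    let χ : L →ₗ[ℂ] (g.ds (x (Fin.last k)) (hx _ _)).cartan :=
      { toFun l := ⟨g.evenClass _ (hx _ _) (φ l) (hφ l _), ⟨φ l, hφ l _⟩, (φ l).2, rfl⟩
        map_add' a b := by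
          apply Subtype.ext
          simp only [map_add]
          rfl
        map_smul' r a := by
          apply Subtype.ext
          simp only [map_smul]
          rfl }
    exact (pullback_dsComp k _ (descend x hx) (descend_sq x hx) χ
      (fun l => descend_rep x hx _ (hφ l)) ψ hψ (dsHom _ _ f)).trans
      (pullback_dsHom_of_eq _ _ φ (fun l => hφ l _) χ (fun _ => rfl) f)

theorem Contraction.transport_iso {k : ℕ} {x : Fin k → g.odd} (c : Contraction g x)
    (hx : ∀ i j, g.sq (x i) (x j) = 0) (f : J g) :
    (c.iso hx).transport (dsHom (∑ i, x i) (sq_sum x hx) f) =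
      (dsComp k g x hx f : AddMonoidAlgebra ℤ (Module.Dual ℂ (iter k g x hx).cartan)) := by
  let φ : g.cartan.submoduleOf (evenCommon x) →ₗ[ℂ] g.cartan :=
    { toFun a := ⟨a.1, a.2⟩
      map_add' _ _ := rfl
      map_smul' _ _ := rfl }
  let ψ : g.cartan.submoduleOf (evenCommon x) →ₗ[ℂ] (iter k g x hx).cartan :=
    ((evenToIter x hx).domRestrict _).codRestrict _
      fun a => iterEven_mem_cartan k g x hx _ a.1.2 a.2
  let χ : g.cartan.submoduleOf (evenCommon x) →ₗ[ℂ] (g.ds (∑ i, x i) (sq_sum x hx)).cartan :=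
    ((evenToSum x hx).domRestrict _).codRestrict _
      fun a => ⟨⟨a.1, rep_sum x a.1.2⟩, a.2, rfl⟩
  -- Surjectivity onto 𝔥' makes pullback along `ψ` injective, so the identity may be tested on 𝔥 ∩ ⋂
  -- 𝔤^{xᵢ}, where both sides are the restriction of f.
  have hψ : Function.Surjective ψ := by
    rintro ⟨z, hz⟩
    obtain ⟨a, ha, ha', rfl⟩ := c.exists_iterEven_of_mem_cartan hx z hz
    exact ⟨⟨⟨a, ha'⟩, ha⟩, rfl⟩
  have hχ : ((c.iso hx).cartanEquiv.symm : _ →ₗ[ℂ] _) ∘ₗ ψ = χ := by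
    refine LinearMap.ext fun a => ?_
    change (c.iso hx).cartanEquiv.symm (ψ a) = χ a
    rw [LinearEquiv.symm_apply_eq]
    exact Subtype.ext (c.isoEven_apply hx a.1 a.1.2).symm
  apply pullback_injective ψ hψ
  rw [pullback_dsComp k g x hx φ (fun a => a.1.2) ψ (fun _ => rfl), Iso.transport, pullback_comp,
    hχ]
  exact pullback_dsHom_of_eq _ _ φ (fun a => rep_sum x a.1.2) χ (fun _ => rfl) f

end Supercharacters

/-! ### Root spaces and the invariant form. -/

section Brackets

theorem lie_mem_evenRootSpace {α β : Module.Dual ℂ g.cartan} {a b : g.even}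
    (ha : a ∈ g.evenRootSpace α) (hb : b ∈ g.evenRootSpace β) :
    ⁅a, b⁆ ∈ g.evenRootSpace (α + β) := fun h => by
  rw [leibniz_lie, ha h, hb h, smul_lie, lie_smul, ← add_smul, LinearMap.add_apply]

theorem rep_mem_oddRootSpace {α β : Module.Dual ℂ g.cartan} {a : g.even} {v : g.odd}
    (ha : a ∈ g.evenRootSpace α) (hv : v ∈ g.oddRootSpace β) :
    g.rep a v ∈ g.oddRootSpace (α + β) := fun h => by
  have h1 := g.rep_lie h a v
  rw [ha h, hv h, map_smul, map_smul, LinearMap.smul_apply] at h1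
  rw [LinearMap.add_apply, add_smul, h1, sub_add_cancel]

theorem sq_mem_evenRootSpace {α β : Module.Dual ℂ g.cartan} {v w : g.odd}
    (hv : v ∈ g.oddRootSpace α) (hw : w ∈ g.oddRootSpace β) :
    g.sq v w ∈ g.evenRootSpace (α + β) := fun h => by
  rw [g.lie_sq, hv h, hw h, map_smul, map_smul, LinearMap.smul_apply, LinearMap.add_apply,
    add_smul]

end Brackets

namespace IsReductivePair

variable (hg : g.IsReductivePair)
include hg

theorem even_ext {W : Type*} [AddCommGroup W] [Module ℂ W] {p q : g.even →ₗ[ℂ] W}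
    (h : ∀ α, ∀ a ∈ g.evenRootSpace α, p a = q a) : p = q := by
  have h1 : ⨆ α, g.evenRootSpace α ≤ LinearMap.eqLocus p q := iSup_le h
  rw [hg.iSup_even] at h1
  exact LinearMap.ext fun a => h1 trivial

theorem odd_ext {W : Type*} [AddCommGroup W] [Module ℂ W] {p q : g.odd →ₗ[ℂ] W}
    (h : ∀ α, ∀ v ∈ g.oddRootSpace α, p v = q v) : p = q := by
  have h1 : ⨆ α, g.oddRootSpace α ≤ LinearMap.eqLocus p q := iSup_le h
  rw [hg.iSup_odd] at h1
  exact LinearMap.ext fun a => h1 trivial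

theorem mem_evenRootSpace_zero {a : g.even} (ha : a ∈ g.cartan) : a ∈ g.evenRootSpace 0 := by
  rwa [hg.even_zero]

theorem mem_cartan {a : g.even} {α : Module.Dual ℂ g.cartan} (ha : a ∈ g.evenRootSpace α)
    (hα : α = 0) : a ∈ g.cartan := by
  rwa [hα, hg.even_zero] at ha

end IsReductivePair

namespace InvariantForm

variable (F : g.InvariantForm)

/-- Invariance under h ∈ 𝔥 gives (α(h) + β(h))(a, b) = 0. -/
theorem even_eq_zero {α β : Module.Dual ℂ g.cartan} {a b : g.even}
    (ha : a ∈ g.evenRootSpace α) (hb : b ∈ g.evenRootSpace β) (hαβ : α + β ≠ 0) :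
    F.even a b = 0 := by
  by_contra h0
  refine hαβ (LinearMap.ext fun h => ?_)
  have h1 := F.even_invariant a h b
  rw [← lie_skew, ha h, hb h, map_neg, map_smul, map_smul, LinearMap.neg_apply,
    LinearMap.smul_apply, smul_eq_mul, smul_eq_mul] at h1
  have h2 : (α h + β h) * F.even a b = 0 := by linear_combination -h1
  exact (mul_eq_zero.mp h2).resolve_right h0

theorem odd_eq_zero {α β : Module.Dual ℂ g.cartan} {v w : g.odd}
    (hv : v ∈ g.oddRootSpace α) (hw : w ∈ g.oddRootSpace β) (hαβ : α + β ≠ 0) :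
    F.odd v w = 0 := by
  by_contra h0
  refine hαβ (LinearMap.ext fun h => ?_)
  have h1 := F.odd_invariant h v w
  have h2 := F.odd_invariant h w v
  rw [hv h, map_smul, LinearMap.smul_apply, smul_eq_mul] at h1
  rw [hw h, map_smul, LinearMap.smul_apply, smul_eq_mul, g.sq_comm, ← h1, F.odd_skew] at h2
  have h3 : (α h + β h) * F.odd v w = 0 := by linear_combination -h2
  exact (mul_eq_zero.mp h3).resolve_right h0

theorem exists_even_dual (hg : g.IsReductivePair) {γ : Module.Dual ℂ g.cartan} {e : g.even}
    (he : e ∈ g.evenRootSpace γ) (he0 : e ≠ 0) : ∃ f ∈ g.evenRootSpace (-γ), F.even e f = 1 := by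
  by_contra! hf
  have h0 : ∀ f ∈ g.evenRootSpace (-γ), F.even e f = 0 := fun f hf' => by
    by_contra h
    refine hf ((F.even e f)⁻¹ • f) (Submodule.smul_mem _ _ hf') ?_
    rw [map_smul, smul_eq_mul, inv_mul_cancel₀ h]
  refine he0 (F.even_nondegenerate e fun b => ?_)
  have h1 : F.even e = 0 := hg.even_ext fun α a ha => by
    by_cases hα : γ + α = 0
    · exact h0 a (by rwa [neg_eq_of_add_eq_zero_right hα])
    · exact F.even_eq_zero he ha hα
  rw [h1]
  rfl

theorem exists_odd_dual (hg : g.IsReductivePair) {γ : Module.Dual ℂ g.cartan} {e : g.odd}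
    (he : e ∈ g.oddRootSpace γ) (he0 : e ≠ 0) : ∃ f ∈ g.oddRootSpace (-γ), F.odd e f = 1 := by
  by_contra! hf
  have h0 : ∀ f ∈ g.oddRootSpace (-γ), F.odd e f = 0 := fun f hf' => by
    by_contra h
    refine hf ((F.odd e f)⁻¹ • f) (Submodule.smul_mem _ _ hf') ?_
    rw [map_smul, smul_eq_mul, inv_mul_cancel₀ h]
  refine he0 (F.odd_nondegenerate e fun b => ?_)
  have h1 : F.odd e = 0 := hg.odd_ext fun α a ha => by
    by_cases hα : γ + α = 0
    · exact h0 a (by rwa [neg_eq_of_add_eq_zero_right hα])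
    · exact F.odd_eq_zero he ha hα
  rw [h1]
  rfl

theorem eq_zero_of_cartan (hg : g.IsReductivePair) {t : g.even} (ht : t ∈ g.cartan)
    (h : ∀ s : g.cartan, F.even t s = 0) : t = 0 := by
  by_contra h0
  obtain ⟨f, hf, h1⟩ := F.exists_even_dual hg (hg.mem_evenRootSpace_zero ht) h0
  rw [h ⟨f, hg.mem_cartan hf neg_zero⟩] at h1
  exact zero_ne_one h1

/-- The isomorphism `𝔥 ≃ 𝔥^*`, `t ↦ (t, ·)`. -/
def cartanEquivDual (hg : g.IsReductivePair) : g.cartan ≃ₗ[ℂ] Module.Dual ℂ g.cartan :=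
  haveI := hg.finite_even
  LinearMap.linearEquivOfInjective (F.even.domRestrict₁₂ g.cartan g.cartan)
    ((injective_iff_map_eq_zero _).2 fun t ht => Subtype.ext <|
      F.eq_zero_of_cartan hg t.2 fun s => LinearMap.congr_fun ht s)
    Subspace.dual_finrank_eq.symm

/-- The element of `𝔥` that represents `α ∈ 𝔥^*`. -/
def vec (hg : g.IsReductivePair) : Module.Dual ℂ g.cartan →ₗ[ℂ] g.cartan :=
  (F.cartanEquivDual hg).symm

variable (hg : g.IsReductivePair)

theorem even_vec (α : Module.Dual ℂ g.cartan) (h : g.cartan) :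
    F.even (F.vec hg α) h = α h :=
  LinearMap.congr_fun ((F.cartanEquivDual hg).apply_symm_apply α) h

theorem eq_smul_vec {t : g.even} (ht : t ∈ g.cartan) {α : Module.Dual ℂ g.cartan} {c : ℂ}
    (h : ∀ s : g.cartan, F.even t s = c * α s) : t = c • (F.vec hg α : g.even) := by
  rw [← sub_eq_zero]
  refine F.eq_zero_of_cartan hg (sub_mem ht (Submodule.smul_mem _ _ (F.vec hg α).2)) fun s => ?_
  rw [map_sub, LinearMap.sub_apply, map_smul, LinearMap.smul_apply, F.even_vec, h, smul_eq_mul,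
    sub_self]

theorem vec_symm (α β : Module.Dual ℂ g.cartan) : α (F.vec hg β) = β (F.vec hg α) := by
  rw [← F.even_vec hg α, F.even_symm, F.even_vec]

theorem orthogonal_iff {α β : Module.Dual ℂ g.cartan} :
    F.Orthogonal α β ↔ β (F.vec hg α) = 0 := by
  constructor
  · rintro ⟨t, ht, h⟩
    have h1 : (t : g.even) = (1 : ℂ) • (F.vec hg α : g.even) :=
      F.eq_smul_vec hg t.2 fun s => by rw [ht, one_mul]
    rw [one_smul] at h1
    rwa [← Subtype.ext h1]
  · exact fun h => ⟨F.vec hg α, F.even_vec hg α, h⟩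

/-- The bracket lies in 𝔥, where an element is determined by its pairings with 𝔥; invariance
computes these as (e, f)γ(s). -/
theorem lie_eq_smul_vec {γ : Module.Dual ℂ g.cartan} {e f : g.even}
    (he : e ∈ g.evenRootSpace γ) (hf : f ∈ g.evenRootSpace (-γ)) :
    ⁅e, f⁆ = F.even e f • (F.vec hg γ : g.even) := by
  refine F.eq_smul_vec hg (hg.mem_cartan (lie_mem_evenRootSpace he hf) (add_neg_cancel γ))
    fun s => ?_
  rw [F.even_invariant, ← lie_skew, hf s, map_neg, map_smul, LinearMap.neg_apply, smul_eq_mul]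
  ring

theorem sq_eq_smul_vec {γ : Module.Dual ℂ g.cartan} {v w : g.odd}
    (hv : v ∈ g.oddRootSpace γ) (hw : w ∈ g.oddRootSpace (-γ)) :
    g.sq v w = F.odd v w • (F.vec hg γ : g.even) := by
  refine F.eq_smul_vec hg (hg.mem_cartan (sq_mem_evenRootSpace hv hw) (add_neg_cancel γ))
    fun s => ?_
  rw [F.even_symm, ← F.odd_invariant, hv s, map_smul, LinearMap.smul_apply, smul_eq_mul, mul_comm]

end InvariantForm

/-! ### Even roots are not isotropic; root strings. -/

/-- Both e and f commute with [e, f], hence preserve its c-eigenspace. There c is a commutator of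
two operators on a nonzero finite-dimensional space, so its trace is zero. -/
theorem trace_lie_eq_zero {L : Type*} [LieRing L] [LieAlgebra ℂ L] [FiniteDimensional ℂ L]
    {e f : L} (he : ⁅⁅e, f⁆, e⁆ = 0) (hf : ⁅⁅e, f⁆, f⁆ = 0) {c : ℂ} {v : L} (hv0 : v ≠ 0)
    (hv : ⁅⁅e, f⁆, v⁆ = c • v) : c = 0 := by
  let U := Module.End.eigenspace (LieAlgebra.ad ℂ L ⁅e, f⁆) c
  have hU : ∀ u, u ∈ U ↔ ⁅⁅e, f⁆, u⁆ = c • u := fun u => Module.End.mem_eigenspace_iff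
  have h1 : ∀ y : L, ⁅⁅e, f⁆, y⁆ = 0 → ∀ u ∈ U, LieAlgebra.ad ℂ L y u ∈ U := fun y hy u hu => by
    rw [hU] at hu ⊢
    rw [LieAlgebra.ad_apply, leibniz_lie, hy, hu, zero_lie, zero_add, lie_smul]
  let E : Module.End ℂ U := (LieAlgebra.ad ℂ L e).restrict (h1 e he)
  let G : Module.End ℂ U := (LieAlgebra.ad ℂ L f).restrict (h1 f hf)
  have h2 : E * G - G * E = c • 1 := by
    ext u
    change ⁅e, ⁅f, (u : L)⁆⁆ - ⁅f, ⁅e, (u : L)⁆⁆ = c • (u : L)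
    rw [← lie_lie, (hU u).1 u.2]
  have h3 := congrArg (LinearMap.trace ℂ U) h2
  rw [map_sub, LinearMap.trace_mul_comm, sub_self, map_smul, LinearMap.trace_one, smul_eq_mul] at h3
  refine (mul_eq_zero.mp h3.symm).resolve_right ?_
  have : Nontrivial U := ⟨⟨v, (hU v).2 hv⟩, 0, fun h => hv0 (congrArg Subtype.val h)⟩
  exact_mod_cast (Module.finrank_pos (R := ℂ) (M := U)).ne'

namespace InvariantForm

variable (F : g.InvariantForm) (hg : g.IsReductivePair)
include F hg

/-- Roots of the even part are not isotropic. -/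
theorem even_eq_zero_of_isotropic {γ : Module.Dual ℂ g.cartan} (hγ : γ ≠ 0)
    (h0 : γ (F.vec hg γ) = 0) {e : g.even} (he : e ∈ g.evenRootSpace γ) : e = 0 := by
  have := hg.finite_even
  by_contra he0
  obtain ⟨f, hf, h1⟩ := F.exists_even_dual hg he he0
  have ht : ⁅e, f⁆ = (F.vec hg γ : g.even) := by rw [F.lie_eq_smul_vec hg he hf, h1, one_smul]
  have hte : ⁅⁅e, f⁆, e⁆ = 0 := by rw [ht, he, h0, zero_smul]
  have htf : ⁅⁅e, f⁆, f⁆ = 0 := by rw [ht, hf, LinearMap.neg_apply, h0, neg_zero, zero_smul]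
  -- Isotropy makes t = [e, f] commute with e and f, so every eigenvalue of ad t on a root space is
  -- zero and t is central.
  have hcen : LieAlgebra.ad ℂ g.even ⁅e, f⁆ = 0 := hg.even_ext fun α a ha => by
    rw [LieAlgebra.ad_apply, ht, ha, LinearMap.zero_apply]
    by_cases ha0 : a = 0
    · rw [ha0, smul_zero]
    · rw [trace_lie_eq_zero hte htf ha0 (c := α (F.vec hg γ)) (by rw [ht, ha]), zero_smul]
  have hc : ∀ b : g.even, ⁅⁅e, f⁆, b⁆ = 0 := fun b => LinearMap.congr_fun hcen b
  -- Modulo the centre, e and f may be replaced by components in a complementary ideal K without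
  -- changing [e, f]. So [e, f] lies in both the centre and K, hence is zero, although it represents
  -- γ ≠ 0.
  obtain ⟨K, hK⟩ := hg.reductive.exists_isCompl (LieAlgebra.center ℂ g.even)
  have hmem : ∀ b : g.even, ∃ z ∈ LieAlgebra.center ℂ g.even, ∃ y ∈ K, z + y = b := fun b =>
    (LieSubmodule.mem_sup _ _ _).1 (hK.sup_eq_top ▸ LieSubmodule.mem_top b)
  obtain ⟨z, hz, y, hy, hzy⟩ := hmem e
  obtain ⟨z', hz', y', hy', hzy'⟩ := hmem f
  have hz1 : ∀ b, ⁅b, z⁆ = 0 := (LieModule.mem_maxTrivSubmodule _ _ _ z).1 hz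
  have hz1' : ∀ b, ⁅b, z'⁆ = 0 := (LieModule.mem_maxTrivSubmodule _ _ _ z').1 hz'
  have h2 : ⁅e, f⁆ = ⁅y, y'⁆ := by
    rw [← hzy, ← hzy', lie_add, hz1', zero_add, add_lie, ← lie_skew, hz1, neg_zero, zero_add]
  have h3 : ⁅e, f⁆ ∈ LieAlgebra.center ℂ g.even ⊓ K :=
    ⟨(LieModule.mem_maxTrivSubmodule _ _ _ _).2 fun b => by rw [← lie_skew, hc, neg_zero],
      h2 ▸ lie_mem_right ℂ g.even K y y' hy'⟩
  rw [hK.inf_eq_bot, LieSubmodule.mem_bot, ht] at h3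
  refine hγ (LinearMap.ext fun s => ?_)
  rw [← F.even_vec hg γ s, h3]
  simp

/-- Pair v with a dual w of weight -γ, so that [v, w] represents γ. If [v, v] = 0, the Jacobi
identity for v, v, w reduces to 2(γ, γ)v = 0. -/
theorem sq_self_ne_zero {γ : Module.Dual ℂ g.cartan} (hγ : γ (F.vec hg γ) ≠ 0) {v : g.odd}
    (hv : v ∈ g.oddRootSpace γ) (hv0 : v ≠ 0) : g.sq v v ≠ 0 := fun h => by
  obtain ⟨w, hw, h1⟩ := F.exists_odd_dual hg hv hv0
  have h2 := g.jacobi v v w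
  rw [g.sq_comm w v, h, map_zero, LinearMap.zero_apply, zero_add, F.sq_eq_smul_vec hg hv hw, h1,
    one_smul, hv, ← two_smul ℂ] at h2
  exact hv0 ((smul_eq_zero.mp ((smul_eq_zero.mp h2).resolve_left two_ne_zero)).resolve_left hγ)

/-- In the 𝔰𝔩₂ attached to γ, u has weight 4. Lowering it twice must give a nonzero vector of weight
0, but the space for δ - 2γ is assumed to vanish. -/
theorem no_root_string {γ δ : Module.Dual ℂ g.cartan} {e u : g.even} (hγ : γ ≠ 0)
    (he : e ∈ g.evenRootSpace γ) (he0 : e ≠ 0) (hu : u ∈ g.evenRootSpace δ) (hu0 : u ≠ 0)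
    (hδ : δ (F.vec hg γ) = 2 * γ (F.vec hg γ))
    (hbot : ∀ a ∈ g.evenRootSpace (δ - 2 • γ), a = 0) : False := by
  have := hg.finite_even
  have hn : γ (F.vec hg γ) ≠ 0 := fun h => he0 (F.even_eq_zero_of_isotropic hg hγ h he)
  obtain ⟨f, hf, h1⟩ := F.exists_even_dual hg he he0
  have ht : ⁅e, f⁆ = (F.vec hg γ : g.even) := by rw [F.lie_eq_smul_vec hg he hf, h1, one_smul]
  set n := γ (F.vec hg γ) with hn'
  -- The roles are reversed: f is the raising operator, and the sign of the Cartan element is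
  -- changed accordingly. Vectors killed by f become primitive.
  have hsl : IsSl2Triple (-(2 / n) • (F.vec hg γ : g.even)) f ((2 / n) • e) :=
    { h_ne_zero := by
        refine smul_ne_zero (neg_ne_zero.2 (div_ne_zero two_ne_zero hn)) fun h => hn ?_
        rw [hn', Subtype.ext (a2 := (0 : g.cartan)) h, map_zero]
      lie_e_f := by
        rw [lie_smul, ← lie_skew, ht, smul_neg, neg_smul]
      lie_h_e_nsmul := by
        rw [smul_lie, hf, LinearMap.neg_apply, ← hn', smul_smul, ← Nat.cast_smul_eq_nsmul ℂ]
        congr 1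
        field_simp
        norm_num
      lie_h_f_nsmul := by
        rw [smul_lie, lie_smul, he, ← hn', smul_smul, smul_smul, ← Nat.cast_smul_eq_nsmul ℂ,
          smul_smul, ← neg_smul]
        congr 1
        field_simp
        norm_num }
  -- A primitive vector in a finite-dimensional module has a natural number as weight, whereas here
  -- the weight is -2(m + 1). The cases used are m = 0 for [f, u] and m = 1 for u.
  have key : ∀ (ε : Module.Dual ℂ g.cartan) (w : g.even) (m : ℕ), w ∈ g.evenRootSpace ε →
      ε (F.vec hg γ) = (m + 1) * n → ⁅f, w⁆ = 0 → w = 0 := fun ε w m hw hε hfw => by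
    by_contra hw0
    have P : hsl.HasPrimitiveVectorWith w (-(2 * (m + 1) : ℂ)) :=
      { ne_zero := hw0
        lie_h := by
          rw [smul_lie, hw, hε, smul_smul]
          congr 1
          field_simp
        lie_e := hfw }
    obtain ⟨l, hl⟩ := P.exists_nat
    have h3 : ((l + 2 * (m + 1) : ℕ) : ℂ) = 0 := by
      push_cast
      linear_combination -hl
    have := Nat.cast_eq_zero.1 h3
    omega
  have hfu := lie_mem_evenRootSpace hf hu
  have hffu := lie_mem_evenRootSpace hf hfu
  have h4 : ⁅f, ⁅f, u⁆⁆ = 0 := hbot _ (by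
    convert hffu using 2
    rw [two_smul]
    abel)
  have h5 : ⁅f, u⁆ = 0 := key _ _ 0 hfu (by
    rw [LinearMap.add_apply, LinearMap.neg_apply, hδ, ← hn']
    push_cast
    ring) h4
  exact hu0 (key δ u 1 hu (by rw [hδ]; push_cast; ring) h5)

variable {β : Module.Dual ℂ g.cartan} (hβ : β ≠ 0) (hββ : β (F.vec hg β) = 0)
include hβ hββ

/-- If v = [a, x] ≠ 0, its root α + β has the same norm as α, which is nonzero. So [v, v] ≠ 0 has
root δ = 2α + 2β, with (δ, α) = 2(α, α). But δ - 2α = 2β is isotropic and nonzero, hence not an even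
root, contradicting `no_root_string` for γ = α. -/
theorem rep_eq_zero_of_orthogonal {x : g.odd} (hx : x ∈ g.oddRootSpace β)
    {α : Module.Dual ℂ g.cartan} (hα : α ≠ 0) (hαβ : α (F.vec hg β) = 0) {a : g.even}
    (ha : a ∈ g.evenRootSpace α) : g.rep a x = 0 := by
  by_contra h0
  have ha0 : a ≠ 0 := fun h => h0 (by rw [h, map_zero, LinearMap.zero_apply])
  have hβα : β (F.vec hg α) = 0 := by rw [F.vec_symm, hαβ]
  have hn : α (F.vec hg α) ≠ 0 := fun h => ha0 (F.even_eq_zero_of_isotropic hg hα h ha)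
  have hv := rep_mem_oddRootSpace ha hx
  have hu0 := F.sq_self_ne_zero hg (by simpa [hαβ, hβα, hββ] using hn) hv h0
  refine F.no_root_string hg hα ha ha0 (sq_mem_evenRootSpace hv hv) hu0 ?_ fun b hb => ?_
  · simp only [LinearMap.add_apply, hβα]
    ring
  · refine F.even_eq_zero_of_isotropic hg (γ := 2 • β) ?_ ?_ ?_
    · exact smul_ne_zero two_ne_zero hβ
    · simp [hββ]
    · convert hb using 2
      simp only [two_smul]
      abel

/-- Odd counterpart: if w = [x, v] ≠ 0, take γ = α + β with root vector w, and δ = 2α with root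
vector [v, v]. Here δ - 2γ = -2β is isotropic and nonzero. -/
theorem sq_eq_zero_of_orthogonal {x : g.odd} (hx : x ∈ g.oddRootSpace β)
    {α : Module.Dual ℂ g.cartan} (hα : β + α ≠ 0) (hαβ : α (F.vec hg β) = 0) {v : g.odd}
    (hv : v ∈ g.oddRootSpace α) : g.sq x v = 0 := by
  by_contra h0
  have hv0 : v ≠ 0 := fun h => h0 (by rw [h, map_zero])
  have hβα : β (F.vec hg α) = 0 := by rw [F.vec_symm, hαβ]
  have hw := sq_mem_evenRootSpace hx hv
  have hn : α (F.vec hg α) ≠ 0 := fun h =>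
    h0 (F.even_eq_zero_of_isotropic hg hα (by simp [hαβ, hβα, hββ, h]) hw)
  have hu0 := F.sq_self_ne_zero hg hn hv hv0
  refine F.no_root_string hg hα hw h0 (sq_mem_evenRootSpace hv hv) hu0 ?_ fun b hb => ?_
  · simp only [map_add, LinearMap.add_apply, hαβ, hβα, hββ]
    ring
  · refine F.even_eq_zero_of_isotropic hg (γ := -(2 • β)) ?_ ?_ ?_
    · exact neg_ne_zero.2 (smul_ne_zero two_ne_zero hβ)
    · simp [hββ]
    · convert hb using 2
      simp only [two_smul]
      abel

end InvariantForm

end CartanPair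

/-! ### Linear algebra for the construction of a contraction. -/

section Linear

variable {V : Type*} [AddCommGroup V] [Module ℂ V]

/-- Produces the operators that act on each root space by a prescribed scalar; with scalars 0 and 1
these are projections. -/
theorem exists_scale {ι : Type*} {U : ι → Submodule ℂ V} (hU : iSupIndep U) (htop : ⨆ i, U i = ⊤)
    (φ : ι → ℂ) : ∃ L : V →ₗ[ℂ] V, ∀ i, ∀ v ∈ U i, L v = φ i • v := by
  classical
  have hint := DirectSum.isInternal_submodule_of_iSupIndep_of_iSup_eq_top hU htop
  let e := LinearEquiv.ofBijective (DirectSum.coeLinearMap U) hint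
  refine ⟨DirectSum.toModule ℂ ι V (fun i => φ i • (U i).subtype) ∘ₗ e.symm.toLinearMap,
    fun i v hv => ?_⟩
  have h1 : e.symm v = DirectSum.lof ℂ ι (fun i => U i) i ⟨v, hv⟩ := by
    rw [LinearEquiv.symm_apply_eq]
    exact (DirectSum.coeLinearMap_lof U i ⟨v, hv⟩).symm
  change DirectSum.toModule ℂ ι V (fun i => φ i • (U i).subtype) (e.symm v) = _
  rw [h1, DirectSum.toModule_lof]
  rfl

theorem exists_dual_family [FiniteDimensional ℂ V] {k : ℕ} {β : Fin k → Module.Dual ℂ V}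
    (hβ : LinearIndependent ℂ β) :
    ∃ h : Fin k → V, ∀ i j, β j (h i) = if i = j then 1 else 0 := by
  classical
  have key : ∀ i, ∃ v : V, ∀ j, β j v = if i = j then 1 else 0 := fun i => by
    obtain ⟨L, hL⟩ := LinearMap.exists_extend
      (Finsupp.lapply i ∘ₗ hβ.repr : Submodule.span ℂ (Set.range β) →ₗ[ℂ] ℂ)
    obtain ⟨v, rfl⟩ := (Module.evalEquiv ℂ V).surjective L
    refine ⟨v, fun j => ?_⟩
    have h1 := LinearMap.congr_fun hL ⟨β j, Submodule.subset_span ⟨j, rfl⟩⟩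
    have h2 : hβ.repr ⟨β j, Submodule.subset_span ⟨j, rfl⟩⟩ = Finsupp.single j 1 :=
      hβ.repr_eq_single j _ rfl
    simp only [LinearMap.comp_apply, h2, Finsupp.lapply_apply, Finsupp.single_apply] at h1
    rw [show β j v = _ from h1]
    exact if_congr eq_comm rfl rfl
  choose h hh using key
  exact ⟨h, hh⟩

/-- The sign is negative because, in the conventions for Dᵢ and sᵢ, the anticommutator with the
bracket by yᵢ is minus the bracket by tᵢ. -/
theorem exists_neg_left_inverse (k : ℕ) : ∃ c : (Fin k → ℂ) → Fin k → ℂ,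
    ∀ τ, ∑ i, c τ i * τ i = if τ = 0 then 0 else -1 := by
  classical
  have key : ∀ τ : Fin k → ℂ, ∃ c : Fin k → ℂ, ∑ i, c i * τ i = if τ = 0 then 0 else -1 :=
    fun τ => by
      by_cases h : τ = 0
      · exact ⟨0, by simp [h]⟩
      · obtain ⟨i, hi⟩ := Function.ne_iff.1 h
        refine ⟨Pi.single i (-(τ i)⁻¹), ?_⟩
        rw [if_neg h, Finset.sum_eq_single i (fun j _ hj => by rw [Pi.single_eq_of_ne hj, zero_mul])
          (by simp), Pi.single_eq_same, neg_mul, inv_mul_cancel₀ hi]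
  choose c hc using key
  exact ⟨c, hc⟩

end Linear

namespace CartanPair

variable {g : CartanPair.{u}}

theorem iSupIndep_evenRootSpace : iSupIndep g.evenRootSpace := by
  let T : g.cartan →ₗ[ℂ] Module.End ℂ g.even :=
    (LieAlgebra.ad ℂ g.even : g.even →ₗ[ℂ] Module.End ℂ g.even) ∘ₗ g.cartan.subtype
  have hT : ∀ a b, Commute (T a) (T b) := fun a b => by
    ext m
    change ⁅(a : g.even), ⁅(b : g.even), m⁆⁆ = ⁅(b : g.even), ⁅(a : g.even), m⁆⁆
    rw [leibniz_lie, g.cartan_comm a a.2 b b.2, zero_lie, zero_add]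
  refine (weightSpace_indep T hT).mono fun α a ha => ?_
  rw [mem_weightSpace]
  refine fun h => ⟨1, ?_⟩
  rw [pow_one, LinearMap.sub_apply]
  exact sub_eq_zero.2 (ha h)

theorem iSupIndep_oddRootSpace : iSupIndep g.oddRootSpace := by
  let T : g.cartan →ₗ[ℂ] Module.End ℂ g.odd := g.rep ∘ₗ g.cartan.subtype
  have hT : ∀ a b, Commute (T a) (T b) := fun a b => by
    ext m
    have h := g.rep_lie a b m
    rw [g.cartan_comm a a.2 b b.2, map_zero, LinearMap.zero_apply] at h
    exact sub_eq_zero.1 h.symm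
  refine (weightSpace_indep T hT).mono fun α a ha => ?_
  rw [mem_weightSpace]
  refine fun h => ⟨1, ?_⟩
  rw [pow_one, LinearMap.sub_apply]
  exact sub_eq_zero.2 (ha h)

/-! ### Bracket relations in an isotropic system. -/

namespace InvariantForm.IsIsotropicSystem

variable {F : g.InvariantForm} (hg : g.IsReductivePair) {k : ℕ}
  {β : Fin k → Module.Dual ℂ g.cartan} (hβ : F.IsIsotropicSystem β)
include hβ

theorem apply_vec (i j : Fin k) : β i (F.vec hg (β j)) = 0 := by
  rw [← F.orthogonal_iff]
  by_cases h : j = i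
  · rw [h]
    exact (hβ.root i).isotropic
  · exact hβ.orthogonal j i h

include hg in
theorem add_ne_zero (i j : Fin k) : β i + β j ≠ 0 := by
  have := hg.finite_even
  by_cases h : i = j
  · rw [h, ← two_smul ℂ]
    exact smul_ne_zero two_ne_zero (hβ.root j).ne_zero
  · intro h1
    obtain ⟨t, ht⟩ := exists_dual_family hβ.independent
    have h2 := LinearMap.congr_fun h1 (t i)
    rw [LinearMap.add_apply, ht, ht, if_pos rfl, if_neg h, add_zero] at h2
    exact one_ne_zero h2

include hg in
/-- Root vectors for the members of an isotropic system supercommute. -/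
theorem sq_eq_zero {x : Fin k → g.odd} (hx : ∀ i, x i ∈ g.oddRootSpace (β i)) (i j : Fin k) :
    g.sq (x i) (x j) = 0 :=
  -- The weight βᵢ + βⱼ is isotropic and nonzero, also for i = j, so it is not an even root.
  F.even_eq_zero_of_isotropic hg (hβ.add_ne_zero hg i j) (by simp [hβ.apply_vec hg])
    (sq_mem_evenRootSpace (hx i) (hx j))

-- The weight βᵢ - βⱼ is isotropic, and nonzero by independence, so it is not an even root. This
-- vanishing is what makes sᵢ anticommute with Dⱼ.
include hg in
theorem sq_eq_zero_of_ne {x y : Fin k → g.odd} (hx : ∀ i, x i ∈ g.oddRootSpace (β i))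
    (hy : ∀ i, y i ∈ g.oddRootSpace (-β i)) {i j : Fin k} (hij : i ≠ j) :
    g.sq (x i) (y j) = 0 := by
  refine F.even_eq_zero_of_isotropic hg (γ := β i + -β j) ?_ (by simp [hβ.apply_vec hg])
    (sq_mem_evenRootSpace (hx i) (hy j))
  rw [← sub_eq_add_neg, sub_ne_zero]
  exact fun h => hij (hβ.independent.injective h)

end InvariantForm.IsIsotropicSystem

namespace InvariantForm.IsIsotropicSystem

section Contraction

variable {F : g.InvariantForm} (hg : g.IsReductivePair) {k : ℕ}
  {β : Fin k → Module.Dual ℂ g.cartan} (hβ : F.IsIsotropicSystem β)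
  {x y : Fin k → g.odd} (hx : ∀ i, x i ∈ g.oddRootSpace (β i))
  (hy : ∀ i, y i ∈ g.oddRootSpace (-β i)) (hxy : ∀ i, F.odd (x i) (y i) • x i = x i)

-- The normalisation (xᵢ, yᵢ)xᵢ = xᵢ replaces (xᵢ, yᵢ) = 1 so as to allow xᵢ = 0, with yᵢ = 0.
include hg hx in
theorem exists_dual_roots : ∃ y : Fin k → g.odd, (∀ i, y i ∈ g.oddRootSpace (-β i)) ∧
    ∀ i, F.odd (x i) (y i) • x i = x i := by
  have key : ∀ i, ∃ y ∈ g.oddRootSpace (-β i), F.odd (x i) y • x i = x i := fun i => by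
    by_cases h : x i = 0
    · exact ⟨0, zero_mem _, by rw [h, smul_zero]⟩
    · obtain ⟨y, hy, h1⟩ := F.exists_odd_dual hg (hx i) h
      exact ⟨y, hy, by rw [h1, one_smul]⟩
  choose y hy hxy using key
  exact ⟨y, hy, hxy⟩

variable (F β x y) in
/-- The values `α([xᵢ, yᵢ])`, where `yᵢ` is a root vector opposite to `xᵢ`. -/
def heights (α : Module.Dual ℂ g.cartan) (i : Fin k) : ℂ :=
  F.odd (x i) (y i) * α (F.vec hg (β i))

include hx hy in
theorem sq_dual (i : Fin k) :
    g.sq (x i) (y i) = F.odd (x i) (y i) • (F.vec hg (β i) : g.even) :=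
  F.sq_eq_smul_vec hg (hx i) (hy i)

include hx hy in
theorem lie_sq_dual {α : Module.Dual ℂ g.cartan} {a : g.even} (ha : a ∈ g.evenRootSpace α)
    (i : Fin k) : ⁅g.sq (x i) (y i), a⁆ = heights F hg β x y α i • a := by
  rw [sq_dual hg hx hy, smul_lie, ha, smul_smul, heights]

include hx hy in
theorem rep_sq_dual {α : Module.Dual ℂ g.cartan} {v : g.odd} (hv : v ∈ g.oddRootSpace α)
    (i : Fin k) : g.rep (g.sq (x i) (y i)) v = heights F hg β x y α i • v := by
  rw [sq_dual hg hx hy, map_smul, LinearMap.smul_apply, hv, smul_smul, heights]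

theorem heights_zero : heights F hg β x y 0 = 0 :=
  funext fun i => by simp [heights]

include hβ

theorem heights_root (i : Fin k) : heights F hg β x y (β i) = 0 :=
  funext fun j => by simp [heights, hβ.apply_vec hg]

/-- Each Dᵢ preserves heights, so any operator scaling root spaces by a function of the heights
commutes with Dᵢ. -/
theorem heights_add (α : Module.Dual ℂ g.cartan) (i : Fin k) :
    heights F hg β x y (α + β i) = heights F hg β x y α :=
  funext fun j => by simp [heights, hβ.apply_vec hg]

theorem heights_neg_root (i : Fin k) : heights F hg β x y (-β i) = 0 :=
  funext fun j => by simp [heights, hβ.apply_vec hg]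

include hx hy hxy

/-- On the root spaces orthogonal to the isotropic system, `[·, xⱼ]` has rank at most one. -/
theorem rep_eq_smul {α : Module.Dual ℂ g.cartan} {a : g.even} (ha : a ∈ g.evenRootSpace α)
    (j : Fin k) : (if heights F hg β x y α = 0 then (1 : ℂ) else 0) • g.rep a (x j) =
      F.even a (g.sq (x j) (y j)) • x j := by
  have h0 : α ≠ 0 → F.even a (g.sq (x j) (y j)) = 0 := fun hα =>
    F.even_eq_zero ha (β := 0) (by
      rw [← add_neg_cancel (β j)]
      exact sq_mem_evenRootSpace (hx j) (hy j)) (by rwa [add_zero])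
  split_ifs with h
  · rw [one_smul]
    -- For a ∈ 𝔥 both sides are βⱼ(a)xⱼ. For α ≠ 0 the form term vanishes, and the bracket vanishes
    -- by orthogonality to βⱼ, unless xⱼ = 0.
    by_cases hα : α = 0
    · have h1 := hx j ⟨a, hg.mem_cartan ha hα⟩
      rw [sq_dual hg hx hy, F.even_symm, map_smul, LinearMap.smul_apply,
        F.even_vec hg (β j) ⟨a, hg.mem_cartan ha hα⟩, smul_eq_mul, mul_comm, mul_smul, hxy]
      exact h1
    · rw [h0 hα, zero_smul]
      by_cases hxj : x j = 0
      · rw [hxj, map_zero]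
      · refine F.rep_eq_zero_of_orthogonal hg (hβ.root j).ne_zero (hβ.apply_vec hg j j) (hx j) hα
          ?_ ha
        refine (mul_eq_zero.mp (congrFun h j)).resolve_left fun h1 => hxj ?_
        rw [← hxy j, h1, zero_smul]
  · rw [zero_smul, h0 (fun hα => h (by rw [hα, heights_zero])), zero_smul]

/-- Counterpart on 𝔤₁: among root vectors of height zero, only those of weight -βⱼ can have a
nonzero bracket with xⱼ, and that bracket is a multiple of [xⱼ, yⱼ]. -/
theorem sq_eq_smul {α : Module.Dual ℂ g.cartan} {v : g.odd} (hv : v ∈ g.oddRootSpace α)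
    (j : Fin k) : (if heights F hg β x y α = 0 then (1 : ℂ) else 0) • g.sq (x j) v =
      F.odd (x j) v • g.sq (x j) (y j) := by
  by_cases hα : β j + α = 0
  · rw [← neg_eq_of_add_eq_zero_right hα] at hv ⊢
    rw [if_pos (hβ.heights_neg_root hg j), one_smul, F.sq_eq_smul_vec hg (hx j) hv,
      sq_dual hg hx hy, smul_smul, mul_comm, ← smul_eq_mul, ← LinearMap.smul_apply, ← map_smul,
      hxy]
  · rw [F.odd_eq_zero (hx j) hv hα, zero_smul]
    split_ifs with h
    · rw [one_smul]
      by_cases hxj : x j = 0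
      · rw [hxj, map_zero, LinearMap.zero_apply]
      · refine F.sq_eq_zero_of_orthogonal hg (hβ.root j).ne_zero (hβ.apply_vec hg j j) (hx j) hα
          ?_ hv
        refine (mul_eq_zero.mp (congrFun h j)).resolve_left fun h1 => hxj ?_
        rw [← hxy j, h1, zero_smul]
    · rw [zero_smul]

end Contraction

/-! ### Construction of the contraction. -/

variable {F : g.InvariantForm} (hg : g.IsReductivePair) {k : ℕ}
  {β : Fin k → Module.Dual ℂ g.cartan} (hβ : F.IsIsotropicSystem β)
  {x : Fin k → g.odd} (hx : ∀ i, x i ∈ g.oddRootSpace (β i))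
include hg hβ hx

theorem nonempty_contraction : Nonempty (Contraction g x) := by
  have := hg.finite_even
  obtain ⟨y, hy, hxy⟩ := exists_dual_roots (F := F) hg hx
  obtain ⟨h, hh⟩ := exists_dual_family hβ.independent
  obtain ⟨c, hc⟩ := exists_neg_left_inverse k
  let τ := heights F hg β x y
  let t (i : Fin k) : g.even := g.sq (x i) (y i)
  have hxx := hβ.sq_eq_zero hg hx
  have hxy0 {i j : Fin k} (hij : i ≠ j) := hβ.sq_eq_zero_of_ne hg hx hy hij
  have hhx (i j : Fin k) : g.rep (h i) (x j) = (if i = j then (1 : ℂ) else 0) • x j := by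
    rw [← hh i j]
    exact hx j (h i)
  have htx (i j : Fin k) : g.rep (t i) (x j) = 0 := by
    rw [rep_sq_dual hg hx hy (hx j), hβ.heights_root hg, Pi.zero_apply, zero_smul]
  have hF1 (a : g.even) (i j : Fin k) :
      F.odd (g.rep a (x j)) (y i) = if i = j then F.even a (t j) else 0 := by
    rw [F.odd_invariant]
    split_ifs with hij
    · rw [hij]
    · rw [hxy0 (Ne.symm hij), map_zero]
  have hF2 (a : g.even) (i j : Fin k) : F.odd (x i) (g.rep a (x j)) = 0 := by
    rw [F.odd_skew, F.odd_invariant, hxx, map_zero, neg_zero]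
  have hF3 (v : g.odd) (i j : Fin k) :
      F.even (g.sq (x j) v) (h i) = if i = j then F.odd (x j) v else 0 := by
    rw [F.even_symm, ← F.odd_invariant, hhx]
    split_ifs with hij
    · rw [one_smul]
    · rw [zero_smul, map_zero, LinearMap.zero_apply]
  have hF4 (v : g.odd) (i j : Fin k) : F.even (g.sq (x j) v) (t i) = 0 := by
    rw [F.even_symm, ← F.odd_invariant, htx, map_zero, LinearMap.zero_apply]
  have hj (i j : Fin k) (v : g.odd) : g.rep (g.sq (y i) v) (x j) + g.rep (g.sq (x j) v) (y i) =
      -g.rep (g.sq (x j) (y i)) v := by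
    rw [eq_neg_iff_add_eq_zero, ← g.jacobi (x j) (y i) v, g.sq_comm v]
    abel
  have hl (i j : Fin k) (a : g.even) : g.sq (x j) (g.rep a (y i)) + g.sq (y i) (g.rep a (x j)) =
      -⁅g.sq (x j) (y i), a⁆ := by
    rw [lie_skew, g.lie_sq, add_comm, g.sq_comm (y i)]
  -- `S i` and `R i` scale root spaces by cᵢ(τ(α)); followed by the bracket with yᵢ, they are the
  -- main part of sᵢ. The coefficients are chosen so that ∑ (Dᵢsᵢ + sᵢDᵢ) is the identity where τ ≠
  -- 0. `P` and `Q` project onto τ = 0.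
  choose S hS using fun i => exists_scale iSupIndep_evenRootSpace hg.iSup_even fun α => c (τ α) i
  choose R hR using fun i => exists_scale iSupIndep_oddRootSpace hg.iSup_odd fun α => c (τ α) i
  obtain ⟨P, hP⟩ := exists_scale iSupIndep_evenRootSpace hg.iSup_even
    fun α => if τ α = 0 then (1 : ℂ) else 0
  obtain ⟨Q, hQ⟩ := exists_scale iSupIndep_oddRootSpace hg.iSup_odd
    fun α => if τ α = 0 then (1 : ℂ) else 0
  have hτ (α : Module.Dual ℂ g.cartan) (j : Fin k) : τ (α + β j) = τ α := hβ.heights_add hg α j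
  have hRS (i j : Fin k) (a : g.even) : R i (g.rep a (x j)) = g.rep (S i a) (x j) := by
    refine LinearMap.congr_fun (f := R i ∘ₗ g.rep.flip (x j)) (g := g.rep.flip (x j) ∘ₗ S i)
      (hg.even_ext fun α a ha => ?_) a
    simp only [LinearMap.comp_apply, LinearMap.flip_apply]
    rw [hR i _ _ (rep_mem_oddRootSpace ha (hx j)), hS i _ _ ha, hτ, map_smul,
      LinearMap.smul_apply]
  have hSR (i j : Fin k) (v : g.odd) : S i (g.sq (x j) v) = g.sq (x j) (R i v) := by
    refine LinearMap.congr_fun (f := S i ∘ₗ g.sq (x j)) (g := g.sq (x j) ∘ₗ R i)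
      (hg.odd_ext fun α v hv => ?_) v
    simp only [LinearMap.comp_apply]
    rw [hS i _ _ (sq_mem_evenRootSpace (hx j) hv), hR i _ _ hv, add_comm, hτ,
      map_smul]
  -- On the part with τ = 0 each Dⱼ is now an explicit map of rank at most one, expressed through
  -- the form.
  have hPx (j : Fin k) (a : g.even) : g.rep (P a) (x j) = F.even a (t j) • x j := by
    refine LinearMap.congr_fun (f := g.rep.flip (x j) ∘ₗ P)
      (g := (LinearMap.flip F.even (t j)).smulRight (x j)) (hg.even_ext fun α a ha => ?_) a
    change g.rep (P a) (x j) = F.even a (t j) • x j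
    rw [← hβ.rep_eq_smul hg hx hy hxy ha j, hP _ _ ha, map_smul, LinearMap.smul_apply]
  have hQx (j : Fin k) (a : g.even) : Q (g.rep a (x j)) = F.even a (t j) • x j := by
    refine LinearMap.congr_fun (f := Q ∘ₗ g.rep.flip (x j))
      (g := (LinearMap.flip F.even (t j)).smulRight (x j)) (hg.even_ext fun α a ha => ?_) a
    change Q (g.rep a (x j)) = F.even a (t j) • x j
    rw [← hβ.rep_eq_smul hg hx hy hxy ha j, hQ _ _ (rep_mem_oddRootSpace ha (hx j)),
      hτ]
  have hxQ (j : Fin k) (v : g.odd) : g.sq (x j) (Q v) = F.odd (x j) v • t j := by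
    refine LinearMap.congr_fun (f := g.sq (x j) ∘ₗ Q)
      (g := (F.odd (x j)).smulRight (t j)) (hg.odd_ext fun α v hv => ?_) v
    change g.sq (x j) (Q v) = F.odd (x j) v • t j
    rw [← hβ.sq_eq_smul hg hx hy hxy hv j, hQ _ _ hv, map_smul]
  have hxP (j : Fin k) (v : g.odd) : P (g.sq (x j) v) = F.odd (x j) v • t j := by
    refine LinearMap.congr_fun (f := P ∘ₗ g.sq (x j))
      (g := (F.odd (x j)).smulRight (t j)) (hg.odd_ext fun α v hv => ?_) v
    change P (g.sq (x j) v) = F.odd (x j) v • t j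
    rw [← hβ.sq_eq_smul hg hx hy hxy hv j, hP _ _ (sq_mem_evenRootSpace (hx j) hv), add_comm,
      hτ]
  have hcP (α : Module.Dual ℂ g.cartan) :
      (if τ α = 0 then (1 : ℂ) else 0) = 1 + ∑ i, c (τ α) i * τ α i := by
    rw [hc]
    split_ifs <;> norm_num
  have hPS (a : g.even) : P a = a + ∑ i, ⁅t i, S i a⁆ := by
    refine LinearMap.congr_fun (f := P)
      (g := LinearMap.id + ∑ i, (LieAlgebra.ad ℂ g.even (t i) : Module.End ℂ g.even) ∘ₗ S i)
      (hg.even_ext fun α a ha => ?_) a |>.trans ?_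
    · rw [LinearMap.add_apply, LinearMap.sum_apply, hP _ _ ha, hcP, add_smul, one_smul,
        Finset.sum_smul]
      refine congrArg (a + ·) (Finset.sum_congr rfl fun i _ => ?_)
      rw [LinearMap.comp_apply, LieAlgebra.ad_apply, hS i _ _ ha, lie_smul,
        lie_sq_dual hg hx hy ha, smul_smul]
    · rw [LinearMap.add_apply, LinearMap.sum_apply]
      rfl
  have hQR (v : g.odd) : Q v = v + ∑ i, g.rep (t i) (R i v) := by
    refine LinearMap.congr_fun (f := Q)
      (g := LinearMap.id + ∑ i, g.rep (t i) ∘ₗ R i)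
      (hg.odd_ext fun α v hv => ?_) v |>.trans ?_
    · rw [LinearMap.add_apply, LinearMap.sum_apply, hQ _ _ hv, hcP, add_smul, one_smul,
        Finset.sum_smul]
      refine congrArg (v + ·) (Finset.sum_congr rfl fun i _ => ?_)
      rw [LinearMap.comp_apply, hR i _ _ hv, map_smul, rep_sq_dual hg hx hy hv, smul_smul]
    · rw [LinearMap.add_apply, LinearMap.sum_apply]
      rfl
  have htc (i : Fin k) : t i ∈ g.cartan :=
    hg.mem_cartan (sq_mem_evenRootSpace (hx i) (hy i)) (add_neg_cancel _)
  have hPc (a : g.even) (ha : a ∈ g.cartan) : P a ∈ g.cartan := by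
    rw [hP 0 a (hg.mem_evenRootSpace_zero ha)]
    exact Submodule.smul_mem _ _ ha
  -- The remaining nonzero values are Dⱼhⱼ = xⱼ and Dⱼyⱼ = tⱼ. The extra terms in `se` and `so`
  -- reverse these arrows when xⱼ ≠ 0, sending tⱼ to yⱼ and xⱼ to hⱼ; the sums subtracted in `pe`
  -- and `po` are the resulting anticommutators.
  let pe : g.even →ₗ[ℂ] g.even := P - ∑ i, ((LinearMap.flip F.even (h i)).smulRight (t i) +
    (LinearMap.flip F.even (t i)).smulRight (h i : g.even))
  let po : g.odd →ₗ[ℂ] g.odd := Q - ∑ i, ((LinearMap.flip F.odd (y i)).smulRight (x i) +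
    (F.odd (x i)).smulRight (y i))
  let se (i : Fin k) : g.even →ₗ[ℂ] g.odd :=
    g.rep.flip (y i) ∘ₗ S i + (LinearMap.flip F.even (h i)).smulRight (y i)
  let so (i : Fin k) : g.odd →ₗ[ℂ] g.even :=
    g.sq (y i) ∘ₗ R i + (LinearMap.flip F.odd (y i)).smulRight (h i : g.even)
  have hpe (a : g.even) : pe a = P a - ∑ i, (F.even a (h i) • t i +
      F.even a (t i) • (h i : g.even)) := by
    rw [LinearMap.sub_apply, LinearMap.sum_apply]
    rfl
  have hpo (v : g.odd) : po v = Q v - ∑ i, (F.odd v (y i) • x i + F.odd (x i) v • y i) := by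
    rw [LinearMap.sub_apply, LinearMap.sum_apply]
    rfl
  have hse (i : Fin k) (a : g.even) : se i a = g.rep (S i a) (y i) + F.even a (h i) • y i := rfl
  have hso (i : Fin k) (v : g.odd) :
      so i v = g.sq (y i) (R i v) + F.odd v (y i) • (h i : g.even) := rfl
  clear_value pe po se so
  -- One formula serves both purposes: for i ≠ j every term contains [xⱼ, yᵢ] = 0 or a vanishing
  -- Kronecker factor, and for i = j it gives the summand of the homotopy formula.
  have hE (i j : Fin k) (a : g.even) : g.sq (x j) (se i a) + so i (g.rep a (x j)) =
      -⁅g.sq (x j) (y i), S i a⁆ + (F.even a (h i) • g.sq (x j) (y i) +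
        (if i = j then F.even a (t j) else 0) • (h i : g.even)) := by
    rw [← hl, hse, hso, hRS, hF1, map_add, map_smul]
    abel
  have hO (i j : Fin k) (v : g.odd) : g.rep (so i v) (x j) + se i (g.sq (x j) v) =
      -g.rep (g.sq (x j) (y i)) (R i v) + (F.odd v (y i) • (if i = j then (1 : ℂ) else 0) • x j +
        (if i = j then F.odd (x j) v else 0) • y i) := by
    rw [← hj, hse, hso, hSR, hF3, map_add, LinearMap.add_apply, map_smul, LinearMap.smul_apply,
      hhx]
    abel
  have hE' (i : Fin k) (a : g.even) : g.sq (x i) (se i a) + so i (g.rep a (x i)) =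
      -⁅t i, S i a⁆ + (F.even a (h i) • t i + F.even a (t i) • (h i : g.even)) :=
    (hE i i a).trans (by rw [if_pos rfl])
  have hO' (i : Fin k) (v : g.odd) : g.rep (so i v) (x i) + se i (g.sq (x i) v) =
      -g.rep (t i) (R i v) + (F.odd v (y i) • x i + F.odd (x i) v • y i) :=
    (hO i i v).trans (by rw [if_pos rfl, if_pos rfl, one_smul])
  exact ⟨{
    projEven := pe
    projOdd := po
    homEven := se
    homOdd := so
    rep_projEven a j := by
      simp [hpe, hPx, htx, hhx]
    sq_projOdd v j := by
      rw [hpo, map_sub, hxQ, map_sum, Finset.sum_eq_single j]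
      · simp [hxx, t]
      · intro i _ hij
        simp [hxx, hxy0 hij.symm]
      · simp
    projOdd_rep a j := by
      simp [hpo, hQx, hF1, hF2]
    projEven_sq v j := by
      simp [hpe, hxP, hF3, hF4]
    homotopyEven a := by
      simp only [hE', hpe, hPS, Finset.sum_add_distrib, Finset.sum_neg_distrib]
      abel
    homotopyOdd v := by
      simp only [hO', hpo, hQR, Finset.sum_add_distrib, Finset.sum_neg_distrib]
      abel
    anticommEven i j hij a := by
      rw [hE, hxy0 hij.symm, if_neg hij]
      simp
    anticommOdd i j hij v := by
      rw [hO, hxy0 hij.symm, if_neg hij, if_neg hij]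
      simp
    projEven_cartan a ha := by
      rw [hpe]
      exact sub_mem (hPc a ha) (sum_mem fun i _ => add_mem (Submodule.smul_mem _ _ (htc i))
        (Submodule.smul_mem _ _ (h i).2)) }⟩

end InvariantForm.IsIsotropicSystem

end CartanPair

end DufloSerganova

end

theorem mainTheorem3 (g : DufloSerganova.CartanPair.{u}) (hg : g.IsReductivePair)
    (F : g.InvariantForm) (k : ℕ) (β : Fin k → Module.Dual ℂ g.cartan)
    (hβ : F.IsIsotropicSystem β) (x : Fin k → g.odd) (hx : ∀ i, x i ∈ g.oddRootSpace (β i)) :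
    ∃ (hc : ∀ i j, g.sq (x i) (x j) = 0)
      (Φ : (g.ds (∑ i, x i) (DufloSerganova.CartanPair.sq_sum x hc)).Iso
        (DufloSerganova.CartanPair.iter k g x hc)),
      (∀ (a : g.even) (ha : ∀ i, g.rep a (x i) = 0),
        Φ.even (g.evenClass _ (DufloSerganova.CartanPair.sq_sum x hc) a
          (DufloSerganova.CartanPair.rep_sum x ha)) =
          DufloSerganova.CartanPair.iterEven k g x hc a ha) ∧
      (∀ (v : g.odd) (hv : ∀ i, g.sq (x i) v = 0),
        Φ.odd (g.oddClass _ (DufloSerganova.CartanPair.sq_sum x hc) v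
          (DufloSerganova.CartanPair.sq_sum_left x hv)) =
          DufloSerganova.CartanPair.iterOdd k g x hc v hv) ∧
      ∀ f : DufloSerganova.CartanPair.J g,
        Φ.transport (DufloSerganova.CartanPair.dsHom (∑ i, x i)
          (DufloSerganova.CartanPair.sq_sum x hc) f) =
          (DufloSerganova.CartanPair.dsComp k g x hc f :
            AddMonoidAlgebra ℤ (Module.Dual ℂ (DufloSerganova.CartanPair.iter k g x hc).cartan)) := by
  obtain ⟨c⟩ := hβ.nonempty_contraction hg hx
  have hc := hβ.sq_eq_zero hg hx
  exact ⟨hc, c.iso hc, c.isoEven_apply hc, c.isoOdd_apply hc, c.transport_iso hc⟩
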